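/- Let $\mathbb K$ be a normed division algebra, i.e. a finite-dimensional, not necessarily associative real algebra with unit and conjugation $*$, with $\mathrm{Re}(a)=\frac12(a+a^*)\in\mathbb R$ and with norm $|a|=\sqrt{aa^*}$ satisfying $|ab|=|a||b|$. Let $V=\mathfrak h_2(\mathbb K)$ be the real vector space of hermitian $2\times2$ matrices over $\mathbb K$, with the Minkowski metric $g$ determined by $g(A,A)=-\det A$, and let $S_+=\mathbb K^2$. For $\mathbb K=\mathbb R,\mathbb C,\mathbb H,\mathbb O$ the dimension of $V$ is $3,4,6,10$. Put $\tilde A=A-(\mathrm{tr}\,A)1$ and $\psi\cdot\phi=\widetilde{\psi\phi^\dagger+\phi\psi^\dagger}\in V$ for $\psi,\phi\in S_+$. The supertranslation algebra $T=V\oplus S_+$ is the Lie superalgebra with even part $V$, odd part $S_+$, and bracket $[(A,\psi),(B,\phi)]=(\psi\cdot\phi,0)$. Let $\alpha:\Lambda^3T\to\mathbb R$ be the unique super-skew-symmetric trilinear form with $\alpha(\psi,\phi,A)=g(\psi\cdot\phi,A)$ for $\psi,\phi\in S_+$, $A\in V$, that vanishes on homogeneous arguments unless one is a vector and two are spinors.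 A Lie $n$-superalgebra is an $L_\infty$-superalgebra (a $\mathbb Z_2$-graded chain complex with super-antisymmetric, parity-preserving brackets $l_k$ of degree $k-2$, $k\ge1$, satisfying the generalized Jacobi identities) whose nonzero terms have degrees in $\{0,\dots,n-1\}$. For $m\ge1$, an $L_\infty$-superalgebra whose only nonzero terms are $V_0$ and $V_m$ and whose differential $l_1$ vanishes corresponds to the quadruple $(\mathfrak g,R,\rho,\omega)$ with $\mathfrak g=V_0$ (a Lie superalgebra under $l_2$), $R=V_m$, $\rho(x)f=l_2(x,f)$, and $\omega=l_{m+2}|_{\mathfrak g}$, an even $(m+2)$-cocycle on $\mathfrak g$ with values in $R$. For $n\ge2$, a Lie $n$-superalgebra is exact if it is of this form with $m=n-1$ and $\omega$ is a coboundary. Then there exists a non-exact Lie 2-superalgebra $A$ that corresponds, up to isomorphism of the quadruple, to $(T,\mathbb R,0,\alpha)$, where $\mathbb R$ is purely even with the trivial action of $T$; in particular $\alpha$ is an even 3-cocycle. Moreover $A$ is an extension of $T$: there is a short exact sequence $0\to b\mathbb R\to A\to T\to0$ of $L_\infty$-superalgebras, where $b\mathbb R$ is the abelian one with $\mathbb R$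 in degree 1 and all other terms zero. In particular this holds in spacetime dimensions $3,4,6$ and $10$. -/

import Mathlib

/-! ## Normed division algebras -/

/-- A normed division algebra, presented through its conjugation `star`: a nonzero
finite-dimensional real unital algebra, not assumed associative, with an involution such that
`a + a* = 2 Re(a) 1` is real and such that the norm `|a| = √(Re (a a*))` is positive definite and
satisfies `|a b| = |a| |b|`. -/
class NormedDivisionAlgebra (K : Type*) [NonAssocRing K] [StarRing K] [Module ℝ K] : Type _
    extends IsScalarTower ℝ K K, SMulCommClass ℝ K K, StarModule ℝ K, Module.Finite ℝ K,
      Nontrivial K where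
  /-- The real part. -/
  re : K →ₗ[ℝ] ℝ
  add_star_eq : ∀ a : K, a + star a = (2 * re a) • (1 : K)
  normSq_pos : ∀ a : K, a ≠ 0 → 0 < re (a * star a)
  normSq_mul : ∀ a b : K,
    re ((a * b) * star (a * b)) = re (a * star a) * re (b * star b)

/-- The octonions, as the Cayley-Dickson double of the quaternions. -/
def Octonion : Type := Quaternion ℝ × Quaternion ℝ

noncomputable section Octonions

namespace Octonion

instance : AddCommGroup Octonion := inferInstanceAs (AddCommGroup (Quaternion ℝ × Quaternion ℝ))

instance : Module ℝ Octonion := inferInstanceAs (Module ℝ (Quaternion ℝ × Quaternion ℝ))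

/-- `(a, b) (c, d) = (a c - d* b, d a + b c*)`. -/
instance : Mul Octonion :=
  ⟨fun x y => (x.1 * y.1 - star y.2 * x.2, y.2 * x.1 + x.2 * star y.1)⟩

instance : One Octonion := ⟨(1, 0)⟩

/-- `(a, b)* = (a*, -b)`. -/
instance : Star Octonion := ⟨fun x => (star x.1, -x.2)⟩

theorem ext {x y : Octonion} (h₁ : x.1 = y.1) (h₂ : x.2 = y.2) : x = y := Prod.ext h₁ h₂

@[simp] theorem add_fst (x y : Octonion) : (x + y).1 = x.1 + y.1 := rfl
@[simp] theorem add_snd (x y : Octonion) : (x + y).2 = x.2 + y.2 := rfl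
@[simp] theorem zero_fst : (0 : Octonion).1 = 0 := rfl
@[simp] theorem zero_snd : (0 : Octonion).2 = 0 := rfl
@[simp] theorem one_fst : (1 : Octonion).1 = 1 := rfl
@[simp] theorem one_snd : (1 : Octonion).2 = 0 := rfl
@[simp] theorem smul_fst (r : ℝ) (x : Octonion) : (r • x).1 = r • x.1 := rfl
@[simp] theorem smul_snd (r : ℝ) (x : Octonion) : (r • x).2 = r • x.2 := rfl
@[simp] theorem mul_fst (x y : Octonion) : (x * y).1 = x.1 * y.1 - star y.2 * x.2 := rfl
@[simp] theorem mul_snd (x y : Octonion) : (x * y).2 = y.2 * x.1 + x.2 * star y.1 := rfl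
@[simp] theorem star_fst (x : Octonion) : (star x).1 = star x.1 := rfl
@[simp] theorem star_snd (x : Octonion) : (star x).2 = -x.2 := rfl

instance : NonAssocRing Octonion :=
  { (inferInstance : AddCommGroup Octonion), (inferInstance : Mul Octonion),
    (inferInstance : One Octonion) with
    left_distrib := fun x y z => by
      apply ext <;> simp [mul_add, add_mul] <;> abel
    right_distrib := fun x y z => by
      apply ext <;> simp [mul_add, add_mul] <;> abel
    zero_mul := fun x => by apply ext <;> simp
    mul_zero := fun x => by apply ext <;> simp
    one_mul := fun x => by apply ext <;> simp
    mul_one := fun x => by apply ext <;> simp }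

instance : StarRing Octonion where
  star_involutive x := by apply ext <;> simp
  star_mul x y := by
    apply ext <;> simp
  star_add x y := by
    apply ext
    · simp
    · simp; abel

instance : Nontrivial Octonion := inferInstanceAs (Nontrivial (Quaternion ℝ × Quaternion ℝ))

instance : NormedDivisionAlgebra Octonion where
  smul_assoc r x y := by apply ext <;> simp [smul_sub]
  smul_comm r x y := by apply ext <;> simp [smul_sub]
  star_smul r x := by apply ext <;> simp
  fg_top := (inferInstance : Module.Finite ℝ (Quaternion ℝ × Quaternion ℝ)).fg_top
  exists_pair_ne := exists_pair_ne Octonion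
  re :=
    { toFun := fun x => x.1.re
      map_add' := fun _ _ => rfl
      map_smul' := fun _ _ => rfl }
  add_star_eq x := by
    apply ext
    · change x.1 + star x.1 = (2 * x.1.re) • (1 : Quaternion ℝ)
      rw [Quaternion.self_add_star]
      simp [Algebra.smul_def]
      exact Or.inl rfl
    · simp
  normSq_pos x hx := by
    have h : x.1 ≠ 0 ∨ x.2 ≠ 0 := by
      by_contra! h
      exact hx (ext h.1 h.2)
    have e : (x * star x).1.re = Quaternion.normSq x.1 + Quaternion.normSq x.2 := by
      simp [Quaternion.normSq_def']; ring
    have h₁ := Quaternion.normSq_nonneg (a := x.1)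
    have h₂ := Quaternion.normSq_nonneg (a := x.2)
    change 0 < (x * star x).1.re
    rw [e]
    rcases h with h | h
    · have := lt_of_le_of_ne h₁ (Ne.symm (Quaternion.normSq_ne_zero.2 h))
      linarith
    · have := lt_of_le_of_ne h₂ (Ne.symm (Quaternion.normSq_ne_zero.2 h))
      linarith
  normSq_mul x y := by
    change ((x * y) * star (x * y)).1.re = (x * star x).1.re * (y * star y).1.re
    simp
    ring

end Octonion

instance : NormedDivisionAlgebra ℝ where
  re := LinearMap.id
  add_star_eq a := by simp [two_mul]
  normSq_pos a ha := by simpa using mul_self_pos.2 ha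
  normSq_mul a b := by simp; ring

instance : NormedDivisionAlgebra ℂ where
  re := Complex.reLm
  add_star_eq a := by apply Complex.ext <;> simp [two_mul]
  normSq_pos a ha := by
    have := Complex.normSq_pos.2 ha
    simpa [Complex.normSq_apply] using this
  normSq_mul a b := by simp; ring

instance : NormedDivisionAlgebra (Quaternion ℝ) where
  star_smul r x := by ext <;> simp
  re :=
    { toFun := fun x => x.re
      map_add' := fun _ _ => rfl
      map_smul' := fun _ _ => rfl }
  add_star_eq a := by
    change a + star a = (2 * a.re) • (1 : Quaternion ℝ)
    rw [Quaternion.self_add_star]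
    simp [Algebra.smul_def]
    exact Or.inl rfl
  normSq_pos a ha := by
    have h := lt_of_le_of_ne (Quaternion.normSq_nonneg (a := a))
      (Ne.symm (Quaternion.normSq_ne_zero.2 ha))
    rw [Quaternion.normSq_def] at h
    exact h
  normSq_mul a b := by
    change ((a * b) * star (a * b)).re = (a * star a).re * (b * star b).re
    simp
    ring

end Octonions

/-! ## Signs, super vector spaces and Lie superalgebras -/

/-- The sign `(-1) ^ a` of a parity `a`. -/
def paritySign (a : ZMod 2) : ℤ := (-1) ^ a.val

/-- The Koszul sign `ε(σ)` of a permutation of elements of grades `d`: permuting the factors gives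
`x₁ ⋯ xₙ = ε(σ) x_{σ(1)} ⋯ x_{σ(n)}` in the free graded-commutative algebra. Every inversion
contributes the sign of one interchange. -/
def koszulSign {n : ℕ} (σ : Equiv.Perm (Fin n)) (d : Fin n → ZMod 2) : ℤ :=
  ∏ i : Fin n, ∏ j : Fin n, if i < j ∧ σ j < σ i then paritySign (d (σ i) * d (σ j)) else 1

/-- `χ(σ) = sgn(σ) ε(σ)`. -/
def chiSign {n : ℕ} (σ : Equiv.Perm (Fin n)) (d : Fin n → ZMod 2) : ℤ :=
  (Equiv.Perm.sign σ : ℤ) * koszulSign σ d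

/-- A super vector space: a real vector space with a decomposition into an even part `part 0` and
an odd part `part 1`. -/
class SuperSpace (V : Type*) [AddCommGroup V] [Module ℝ V] where
  part : ZMod 2 → Submodule ℝ V
  isCompl : IsCompl (part 0) (part 1)

/-- The real numbers as a purely even super vector space. -/
instance : SuperSpace ℝ where
  part a := if a = 0 then ⊤ else ⊥
  isCompl := by simpa using isCompl_top_bot

/-- Real Lie superalgebras. -/
class LieSuperalgebra (L : Type*) [AddCommGroup L] [Module ℝ L] [SuperSpace L] where
  bracket : L →ₗ[ℝ] L →ₗ[ℝ] L
  bracket_mem : ∀ {a b : ZMod 2} {x y : L}, x ∈ SuperSpace.part a → y ∈ SuperSpace.part b →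
    bracket x y ∈ SuperSpace.part (V := L) (a + b)
  bracket_skew : ∀ {a b : ZMod 2} {x y : L}, x ∈ SuperSpace.part a → y ∈ SuperSpace.part b →
    bracket x y = -(paritySign (a * b) • bracket y x)
  jacobi : ∀ {a b c : ZMod 2} {x y z : L}, x ∈ SuperSpace.part a → y ∈ SuperSpace.part b →
    z ∈ SuperSpace.part c →
    bracket x (bracket y z) =
      bracket (bracket x y) z + paritySign (a * b) • bracket y (bracket x z)

/-- A representation of a Lie superalgebra `L` on a super vector space `R`, that is, a homomorphism
of Lie superalgebras from `L` to `gl(R)`. -/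
structure SuperRep (L R : Type*) [AddCommGroup L] [Module ℝ L] [SuperSpace L] [LieSuperalgebra L]
    [AddCommGroup R] [Module ℝ R] [SuperSpace R] where
  act : L →ₗ[ℝ] R →ₗ[ℝ] R
  act_mem : ∀ {a b : ZMod 2} {x : L} {v : R}, x ∈ SuperSpace.part a → v ∈ SuperSpace.part b →
    act x v ∈ SuperSpace.part (V := R) (a + b)
  act_bracket : ∀ {a b : ZMod 2} {x y : L} (v : R), x ∈ SuperSpace.part a →
    y ∈ SuperSpace.part b →
    act (LieSuperalgebra.bracket x y) v = act x (act y v) - paritySign (a * b) • act y (act x v)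

/-- The trivial representation. -/
def SuperRep.trivial (L R : Type*) [AddCommGroup L] [Module ℝ L] [SuperSpace L]
    [LieSuperalgebra L] [AddCommGroup R] [Module ℝ R] [SuperSpace R] : SuperRep L R where
  act := 0
  act_mem _ _ := by simp
  act_bracket _ _ _ := by simp

/-! ## Cohomology of Lie superalgebras -/

section Cohomology

variable {L R : Type*} [AddCommGroup L] [Module ℝ L] [SuperSpace L]
  [AddCommGroup R] [Module ℝ R] [SuperSpace R]

/-- `n`-cochains are the super-skew-symmetric `n`-linear maps. -/
def IsCochain {n : ℕ} (ω : MultilinearMap ℝ (fun _ : Fin n => L) R) : Prop :=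
  ∀ (σ : Equiv.Perm (Fin n)) (a : Fin n → ZMod 2) (x : Fin n → L),
    (∀ i, x i ∈ SuperSpace.part (a i)) → ω (x ∘ σ) = chiSign σ a • ω x

/-- The multilinear map `ω` has parity `c`: it is even (parity-preserving) for `c = 0` and odd
(parity-reversing) for `c = 1`. -/
def HasParity {n : ℕ} (c : ZMod 2) (ω : MultilinearMap ℝ (fun _ : Fin n => L) R) : Prop :=
  ∀ (a : Fin n → ZMod 2) (x : Fin n → L),
    (∀ i, x i ∈ SuperSpace.part (a i)) → ω x ∈ SuperSpace.part (∑ i, a i + c)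

/-- The sign of moving the `i`-th of a sequence of elements of parities `a` to the front. -/
def frontSign {n : ℕ} (a : Fin n → ZMod 2) (i : Fin n) : ℤ :=
  paritySign (a i * ∑ k ∈ Finset.univ.filter (· < i), a k)

variable [LieSuperalgebra L]

/-- The part of `dω` that involves the bracket: the sum over `i < j` of
`(-1)^{i+j} (-1)^{|Xᵢ||Xⱼ|} ε(i) ε(j) ω([Xᵢ, Xⱼ], X₁, …, X̂ᵢ, …, X̂ⱼ, …)`. -/
def coboundaryBracketPart : {n : ℕ} → MultilinearMap ℝ (fun _ : Fin n => L) R →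
    (Fin (n + 1) → ZMod 2) → (Fin (n + 1) → L) → R
  | 0, _, _, _ => 0
  | n + 1, ω, a, X => ∑ i : Fin (n + 1), ∑ j : Fin (n + 2),
      if i.castSucc < j then
        ((-1) ^ ((i : ℕ) + (j : ℕ)) * paritySign (a i.castSucc * a j) *
            frontSign a i.castSucc * frontSign a j : ℤ) •
          ω (Fin.cons (LieSuperalgebra.bracket (X i.castSucc) (X j))
            fun k : Fin n => X (j.succAbove (i.succAbove k)))
      else 0

/-- The value `dω(X₁, …, Xₙ₊₁)` of the coboundary of a cochain `ω` of parity `c` on homogeneous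
elements `Xᵢ` of parities `aᵢ`. -/
def coboundary (ρ : SuperRep L R) {n : ℕ} (c : ZMod 2)
    (ω : MultilinearMap ℝ (fun _ : Fin n => L) R)
    (a : Fin (n + 1) → ZMod 2) (X : Fin (n + 1) → L) : R :=
  (∑ i : Fin (n + 1), ((-1) ^ (i : ℕ) * paritySign (a i * c) * frontSign a i : ℤ) •
      ρ.act (X i) (ω fun k : Fin n => X (i.succAbove k)))
    + coboundaryBracketPart ω a X

/-- Even `n`-cocycles with values in the representation `ρ`. -/
structure IsEvenCocycle (ρ : SuperRep L R) {n : ℕ}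
    (ω : MultilinearMap ℝ (fun _ : Fin n => L) R) : Prop where
  isCochain : IsCochain ω
  even : HasParity 0 ω
  closed : ∀ (a : Fin (n + 1) → ZMod 2) (X : Fin (n + 1) → L),
    (∀ i, X i ∈ SuperSpace.part (a i)) → coboundary ρ 0 ω a X = 0

/-- The `(n+1)`-cochain `ω` is trivial: it is the coboundary of an `n`-cochain, which is written as
the sum of its even part `θ₀` and its odd part `θ₁`. -/
def IsTrivialCocycle (ρ : SuperRep L R) {n : ℕ}
    (ω : MultilinearMap ℝ (fun _ : Fin (n + 1) => L) R) : Prop :=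
  ∃ θ₀ θ₁ : MultilinearMap ℝ (fun _ : Fin n => L) R,
    IsCochain θ₀ ∧ HasParity 0 θ₀ ∧ IsCochain θ₁ ∧ HasParity 1 θ₁ ∧
    ∀ (a : Fin (n + 1) → ZMod 2) (X : Fin (n + 1) → L),
      (∀ i, X i ∈ SuperSpace.part (a i)) →
        ω X = coboundary ρ 0 θ₀ a X + coboundary ρ 1 θ₁ a X

end Cohomology

/-! ## L∞-superalgebras -/

/-- `σ` is an `(i, n-i)`-unshuffle: it is increasing on the first `i` places and on the others. -/
def IsUnshuffle {n : ℕ} (i : ℕ) (σ : Equiv.Perm (Fin n)) : Prop :=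
  ∀ a b : Fin n, a < b → ((b : ℕ) < i ∨ i ≤ (a : ℕ)) → σ a < σ b

instance {n : ℕ} (i : ℕ) : DecidablePred (IsUnshuffle (n := n) i) := fun σ => by
  unfold IsUnshuffle; infer_instance

/-- An L∞-superalgebra on the total space `W` of a super chain complex. The summand `gr p a` is the
part of degree `p` and parity `a`; degrees are nonnegative. Signs are governed by the overall
grade `p + a`. The bracket `l k` is parity-preserving of degree `k - 2` (there is no `0`-ary
bracket), and `l 1` is the differential of the complex. -/
structure LInftySuperalgebra (W : Type*) [AddCommGroup W] [Module ℝ W] where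
  gr : ℤ → ZMod 2 → Submodule ℝ W
  internal : DirectSum.IsInternal fun q : ℤ × ZMod 2 => gr q.1 q.2
  gr_neg : ∀ p a, p < 0 → gr p a = ⊥
  l : ∀ k : ℕ, MultilinearMap ℝ (fun _ : Fin k => W) W
  l_zero : l 0 = 0
  l_mem : ∀ (k : ℕ) (p : Fin k → ℤ) (a : Fin k → ZMod 2) (x : Fin k → W),
    (∀ i, x i ∈ gr (p i) (a i)) → l k x ∈ gr (∑ i, p i + k - 2) (∑ i, a i)
  antisymm : ∀ (k : ℕ) (σ : Equiv.Perm (Fin k)) (p : Fin k → ℤ) (a : Fin k → ZMod 2)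
    (x : Fin k → W), (∀ i, x i ∈ gr (p i) (a i)) →
      l k (x ∘ σ) = chiSign σ (fun i => (p i : ZMod 2) + a i) • l k x
  /-- The sum over `i ≥ 1`, `i + j = n + 1`, and over all `(i, n-i)`-unshuffles `σ`, of
  `χ(σ) (-1)^{i(j-1)} l_j (l_i (x_{σ(1)}, …, x_{σ(i)}), x_{σ(i+1)}, …, x_{σ(n)})` vanishes. -/
  jacobi : ∀ (n : ℕ) (p : Fin n → ℤ) (a : Fin n → ZMod 2) (x : Fin n → W),
    (∀ i, x i ∈ gr (p i) (a i)) →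
      ∑ i : Fin (n + 1), (if (i : ℕ) = 0 then 0 else
        ∑ σ ∈ Finset.univ.filter (IsUnshuffle (n := n) i),
          (chiSign σ (fun m => (p m : ZMod 2) + a m) * (-1) ^ ((i : ℕ) * (n - (i : ℕ))) : ℤ) •
            l (n - (i : ℕ) + 1)
              (Fin.cons (l i fun m : Fin (i : ℕ) => x (σ ⟨m, by omega⟩))
                fun m : Fin (n - (i : ℕ)) => x (σ ⟨(i : ℕ) + m, by omega⟩))) = 0

namespace LInftySuperalgebra

/-- The grading of a super vector space placed in degree `n`. -/
def singleGrading (V : Type*) [AddCommGroup V] [Module ℝ V] [SuperSpace V] (n : ℕ)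
    (p : ℤ) (a : ZMod 2) : Submodule ℝ V :=
  if p = n then SuperSpace.part a else ⊥

theorem singleGrading_isInternal (V : Type*) [AddCommGroup V] [Module ℝ V] [SuperSpace V]
    (n : ℕ) :
    DirectSum.IsInternal fun q : ℤ × ZMod 2 => singleGrading V n q.1 q.2 := by
  have hdis : ∀ a : ZMod 2, Disjoint (SuperSpace.part (V := V) a) (SuperSpace.part (a + 1)) := by
    intro a
    fin_cases a
    · exact SuperSpace.isCompl.disjoint
    · exact SuperSpace.isCompl.disjoint.symm
  have hne : ∀ a b : ZMod 2, b ≠ a → b = a + 1 := by decide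
  rw [DirectSum.isInternal_submodule_iff_iSupIndep_and_iSup_eq_top]
  constructor
  · rintro ⟨p, a⟩
    by_cases hp : p = n
    · refine Disjoint.mono (le_of_eq ?_) ?_ (hdis a)
      · simp [singleGrading, hp]
      · refine iSup₂_le ?_
        rintro ⟨q, b⟩ hq
        by_cases hqn : q = n
        · have hb : b ≠ a := fun h => hq (by rw [hqn, hp, h])
          simp [singleGrading, hqn, hne a b hb]
        · simp [singleGrading, hqn]
    · simp [singleGrading, hp]
  · rw [eq_top_iff, ← (SuperSpace.isCompl (V := V)).sup_eq_top]
    refine sup_le ?_ ?_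
    · refine le_trans (le_of_eq ?_)
        (le_iSup (fun q : ℤ × ZMod 2 => singleGrading V n q.1 q.2) ((n : ℤ), 0))
      simp [singleGrading]
    · refine le_trans (le_of_eq ?_)
        (le_iSup (fun q : ℤ × ZMod 2 => singleGrading V n q.1 q.2) ((n : ℤ), 1))
      simp [singleGrading]

/-- The abelian L∞-superalgebra `bⁿR`, with `R` in degree `n` and zero in the other degrees. -/
def abelian (R : Type*) [AddCommGroup R] [Module ℝ R] [SuperSpace R] (n : ℕ) :
    LInftySuperalgebra R where
  gr := singleGrading R n
  internal := singleGrading_isInternal R n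
  gr_neg p a hp := by
    have : p ≠ n := by omega
    simp [singleGrading, this]
  l _ := 0
  l_zero := rfl
  l_mem _ _ _ _ _ := by simp
  antisymm _ _ _ _ _ _ := by simp
  jacobi _ _ _ _ _ := by simp

/-- The bracket of a Lie superalgebra as a map on pairs. -/
def lieBracketTwo (L : Type*) [AddCommGroup L] [Module ℝ L] [SuperSpace L] [LieSuperalgebra L] :
    MultilinearMap ℝ (fun _ : Fin 2 => L) L where
  toFun x := LieSuperalgebra.bracket (x 0) (x 1)
  map_update_add' := by
    intro inst x i u v
    rw [Subsingleton.elim inst (instDecidableEqFin 2)]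
    fin_cases i <;> simp
  map_update_smul' := by
    intro inst x i c u
    rw [Subsingleton.elim inst (instDecidableEqFin 2)]
    fin_cases i <;> simp

/-- The brackets of a Lie superalgebra regarded as an L∞-superalgebra: `l 2` is the Lie bracket,
and the others vanish. -/
def lieBrackets (L : Type*) [AddCommGroup L] [Module ℝ L] [SuperSpace L] [LieSuperalgebra L] :
    ∀ k : ℕ, MultilinearMap ℝ (fun _ : Fin k => L) L
  | 2 => lieBracketTwo L
  | _ => 0

theorem lieBrackets_ne (L : Type*) [AddCommGroup L] [Module ℝ L] [SuperSpace L]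
    [LieSuperalgebra L] {k : ℕ} (hk : k ≠ 2) : lieBrackets L k = 0 := by
  unfold lieBrackets
  split
  · exact absurd rfl hk
  · rfl

theorem lieBrackets_jacobi (L : Type*) [AddCommGroup L] [Module ℝ L] [SuperSpace L]
    [LieSuperalgebra L] (a : Fin 3 → ZMod 2) (x : Fin 3 → L)
    (hx : ∀ i, x i ∈ SuperSpace.part (a i)) :
    ∑ σ ∈ Finset.univ.filter (IsUnshuffle (n := 3) 2),
      chiSign σ a • LieSuperalgebra.bracket
        (LieSuperalgebra.bracket (x (σ 0)) (x (σ 1))) (x (σ 2)) = 0 := by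
  have hf : Finset.univ.filter (IsUnshuffle (n := 3) 2) =
      {1, Equiv.swap 1 2, finRotate 3} := by decide
  have h1 : ∀ a : Fin 3 → ZMod 2, chiSign (1 : Equiv.Perm (Fin 3)) a = 1 := by decide
  have h2 : ∀ a : Fin 3 → ZMod 2,
      chiSign (Equiv.swap 1 2 : Equiv.Perm (Fin 3)) a = - paritySign (a 1 * a 2) := by decide
  have h3 : ∀ a : Fin 3 → ZMod 2,
      chiSign (finRotate 3) a = paritySign (a 0 * a 1) * paritySign (a 0 * a 2) := by decide
  have e1 : finRotate 3 0 = 1 := by decide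
  have e2 : finRotate 3 1 = 2 := by decide
  have e3 : finRotate 3 2 = 0 := by decide
  have e4 : (Equiv.swap 1 2 : Equiv.Perm (Fin 3)) 0 = 0 := by decide
  have n1 : (1 : Equiv.Perm (Fin 3)) ≠ Equiv.swap 1 2 := by decide
  have n2 : (1 : Equiv.Perm (Fin 3)) ≠ finRotate 3 := by decide
  have n3 : (Equiv.swap 1 2 : Equiv.Perm (Fin 3)) ≠ finRotate 3 := by decide
  rw [hf, Finset.sum_insert (by simp [n1, n2]), Finset.sum_insert (by simp [n3]),
    Finset.sum_singleton, h1, h2, h3, e1, e2, e3, e4]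
  simp only [Equiv.Perm.one_apply, Equiv.swap_apply_left, Equiv.swap_apply_right]
  have j := LieSuperalgebra.jacobi (hx 0) (hx 1) (hx 2)
  have s1 := LieSuperalgebra.bracket_skew (hx 0)
    (LieSuperalgebra.bracket_mem (hx 1) (hx 2))
  have s2 := LieSuperalgebra.bracket_skew (hx 1)
    (LieSuperalgebra.bracket_mem (hx 0) (hx 2))
  have s : ∀ u v w : ZMod 2, paritySign (u * (v + w)) = paritySign (u * v) * paritySign (u * w) := by
    decide
  have q : ∀ u v : ZMod 2, paritySign (u * v) * paritySign (v * u) = 1 := by decide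
  rw [s1, s2, s, s, smul_neg, smul_smul, ← mul_assoc, q, one_mul] at j
  simp only [neg_smul, one_smul] at j ⊢
  have j' := eq_neg_of_add_eq_zero_left (neg_eq_iff_add_eq_zero.1 j)
  rw [j']
  abel

/-- A Lie superalgebra as an L∞-superalgebra concentrated in degree `0`. -/
def ofLie (L : Type*) [AddCommGroup L] [Module ℝ L] [SuperSpace L] [LieSuperalgebra L] :
    LInftySuperalgebra L where
  gr := singleGrading L 0
  internal := singleGrading_isInternal L 0
  gr_neg p a hp := by
    have : p ≠ 0 := by omega
    simp [singleGrading, this]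
  l := lieBrackets L
  l_zero := rfl
  l_mem k p a x hx := by
    by_cases hk : k = 2
    · subst hk
      by_cases hp : ∀ i, p i = 0
      · have h0 := hx 0
        have h1 := hx 1
        simp only [singleGrading, hp, Nat.cast_zero, if_true] at h0 h1
        have := LieSuperalgebra.bracket_mem h0 h1
        simpa [singleGrading, hp, lieBrackets, lieBracketTwo, Fin.sum_univ_two] using this
      · push Not at hp
        obtain ⟨i, hi⟩ := hp
        have h0 : x i = 0 := by simpa [singleGrading, hi] using hx i
        rw [MultilinearMap.map_coord_zero _ i h0]
        exact Submodule.zero_mem _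
    · simp [lieBrackets_ne L hk]
  antisymm k σ p a x hx := by
    by_cases hk : k = 2
    · subst hk
      by_cases hp : ∀ i, p i = 0
      · have h0 := hx 0
        have h1 := hx 1
        simp only [singleGrading, hp, Nat.cast_zero, if_true] at h0 h1
        have hs := LieSuperalgebra.bracket_skew h1 h0
        have hσ : σ = 1 ∨ σ = Equiv.swap 0 1 := by revert σ; decide
        have c1 : ∀ a : Fin 2 → ZMod 2, chiSign (1 : Equiv.Perm (Fin 2)) a = 1 := by decide
        have c2 : ∀ a : Fin 2 → ZMod 2,
            chiSign (Equiv.swap 0 1 : Equiv.Perm (Fin 2)) a = - paritySign (a 1 * a 0) := by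
          decide
        rcases hσ with rfl | rfl
        · rw [c1, one_smul]; rfl
        · rw [c2]
          simpa [hp, lieBrackets, lieBracketTwo] using hs
      · push Not at hp
        obtain ⟨i, hi⟩ := hp
        have h0 : x i = 0 := by simpa [singleGrading, hi] using hx i
        rw [MultilinearMap.map_coord_zero _ i h0,
          MultilinearMap.map_coord_zero _ (σ.symm i) (by simpa using h0), smul_zero]
    · simp [lieBrackets_ne L hk]
  jacobi n p a x hx := by
    by_cases hp : ∀ i, p i = 0
    · refine Finset.sum_eq_zero fun i _ => ?_
      by_cases hi : (i : ℕ) = 2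
      · by_cases hn : n = 3
        · subst hn
          obtain rfl : i = 2 := Fin.ext hi
          have hx' : ∀ i, x i ∈ SuperSpace.part (a i) := fun i => by
            simpa [singleGrading, hp] using hx i
          have := lieBrackets_jacobi L a x hx'
          simp only [hp, Int.cast_zero, zero_add]
          rw [if_neg (by simp)]
          refine Eq.trans (Finset.sum_congr rfl fun σ _ => ?_) this
          change (chiSign σ a * 1 : ℤ) • _ = _
          rw [mul_one]
          rfl
        · rw [if_neg (by omega)]
          refine Finset.sum_eq_zero fun σ _ => ?_
          rw [lieBrackets_ne L (k := n - (i : ℕ) + 1) (by omega)]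
          simp
      · split_ifs
        · rfl
        · refine Finset.sum_eq_zero fun σ _ => ?_
          rw [MultilinearMap.map_coord_zero _ 0, smul_zero]
          rw [Fin.cons_zero, lieBrackets_ne L hi]
          rfl
    · push Not at hp
      obtain ⟨m, hm⟩ := hp
      have h0 : x m = 0 := by simpa [singleGrading, hm] using hx m
      refine Finset.sum_eq_zero fun i _ => ?_
      split_ifs
      · rfl
      · refine Finset.sum_eq_zero fun σ _ => ?_
        by_cases hmi : (σ.symm m : ℕ) < i
        · rw [MultilinearMap.map_coord_zero _ 0, smul_zero]
          rw [Fin.cons_zero]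
          refine MultilinearMap.map_coord_zero _ ⟨(σ.symm m : ℕ), hmi⟩ ?_
          simpa using h0
        · rw [MultilinearMap.map_coord_zero _
            (Fin.succ ⟨(σ.symm m : ℕ) - i, by omega⟩), smul_zero]
          rw [Fin.cons_succ]
          have e : (⟨(i : ℕ) + ((σ.symm m : ℕ) - i), by omega⟩ : Fin n) = σ.symm m :=
            Fin.ext (by simp; omega)
          rw [e]
          simpa using h0

/-- Strict morphisms: degree- and parity-preserving linear maps that commute with all brackets. -/
structure Hom {W W' : Type*} [AddCommGroup W] [Module ℝ W] [AddCommGroup W'] [Module ℝ W']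
    (A : LInftySuperalgebra W) (B : LInftySuperalgebra W') where
  toLin : W →ₗ[ℝ] W'
  map_gr : ∀ (p : ℤ) (a : ZMod 2) (x : W), x ∈ A.gr p a → toLin x ∈ B.gr p a
  map_l : ∀ (k : ℕ) (x : Fin k → W), toLin (A.l k x) = B.l k fun i => toLin (x i)

section

variable {W : Type*} [AddCommGroup W] [Module ℝ W]

/-- `A` is a Lie `n`-superalgebra: its nonzero terms all have degree `< n`. -/
def IsLie (A : LInftySuperalgebra W) (n : ℕ) : Prop :=
  ∀ (p : ℤ) (a : ZMod 2), (n : ℤ) ≤ p → A.gr p a = ⊥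

/-- `A` is an extension of the Lie superalgebra `g` by `bⁿR`: there is a short exact sequence
`0 → bⁿR → A → g → 0` of L∞-superalgebras. -/
def IsExtension (A : LInftySuperalgebra W) (g R : Type*) [AddCommGroup g] [Module ℝ g]
    [SuperSpace g] [LieSuperalgebra g] [AddCommGroup R] [Module ℝ R] [SuperSpace R]
    (n : ℕ) : Prop :=
  ∃ (ι : Hom (abelian R n) A) (π : Hom A (ofLie g)),
    Function.Injective ι.toLin ∧ Function.Exact ι.toLin π.toLin ∧ Function.Surjective π.toLin

/-- `A` corresponds to the quadruple `(g, R, ρ, ω)`, where `g` is a Lie superalgebra, `ρ` a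
representation of `g` on the super vector space `R` and `ω` an even `(n+2)`-cocycle on `g` with
values in `R`: the only nonzero terms of `A` are `A₀ ≅ g` and `Aₙ ≅ R`, the differential vanishes,
the bracket of `A` restricts to the bracket of `g` and to `ρ`, and `l (n + 2)` restricts to `ω`. -/
def CorrespondsTo (A : LInftySuperalgebra W) {g R : Type*} [AddCommGroup g] [Module ℝ g]
    [SuperSpace g] [LieSuperalgebra g] [AddCommGroup R] [Module ℝ R] [SuperSpace R] {n : ℕ}
    (ρ : SuperRep g R) (ω : MultilinearMap ℝ (fun _ : Fin (n + 2) => g) R) : Prop :=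
  0 < n ∧ IsEvenCocycle ρ ω ∧
  (∀ (p : ℤ) (a : ZMod 2), p ≠ 0 → p ≠ n → A.gr p a = ⊥) ∧ A.l 1 = 0 ∧
  ∃ (e₀ : g →ₗ[ℝ] W) (e₁ : R →ₗ[ℝ] W),
    Function.Injective e₀ ∧ Function.Injective e₁ ∧
    (∀ a, (SuperSpace.part a).map e₀ = A.gr 0 a) ∧
    (∀ a, (SuperSpace.part a).map e₁ = A.gr n a) ∧
    (∀ x y : g, A.l 2 ![e₀ x, e₀ y] = e₀ (LieSuperalgebra.bracket x y)) ∧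
    (∀ (x : g) (v : R), A.l 2 ![e₀ x, e₁ v] = e₁ (ρ.act x v)) ∧
    (∀ x : Fin (n + 2) → g, A.l (n + 2) (fun i => e₀ (x i)) = e₁ (ω x))

end

/-- The Lie `(n+1)`-superalgebra `A` is exact: it corresponds to a quadruple `(g, R, ρ, ω)`, so that
only its terms of degree `0` and `n` are nonzero, and the `(n+2)`-cocycle `ω` is trivial. -/
def IsExact.{u} {W : Type u} [AddCommGroup W] [Module ℝ W] (A : LInftySuperalgebra W) (n : ℕ) :
    Prop :=
  A.IsLie (n + 1) ∧
  ∃ (g R : Type u) (_ : AddCommGroup g) (_ : Module ℝ g) (_ : SuperSpace g)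
    (_ : LieSuperalgebra g) (_ : AddCommGroup R) (_ : Module ℝ R) (_ : SuperSpace R)
    (ρ : SuperRep g R) (ω : MultilinearMap ℝ (fun _ : Fin (n + 2) => g) R),
    A.CorrespondsTo ρ ω ∧ IsTrivialCocycle ρ ω

end LInftySuperalgebra

/-! ## Vectors, spinors and the supertranslation algebra -/

noncomputable section Spacetime

variable (K : Type*) [NonAssocRing K] [StarRing K] [Module ℝ K] [NormedDivisionAlgebra K]

/-- The vectors: the hermitian `2 × 2` matrices with entries in `K`. -/
def Vec : Submodule ℝ (Matrix (Fin 2) (Fin 2) K) where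
  carrier := {A | A.conjTranspose = A}
  add_mem' {A B} hA hB := by
    simp only [Set.mem_ofPred_eq] at *
    rw [Matrix.conjTranspose_add, hA, hB]
  zero_mem' := by simp
  smul_mem' r A hA := by
    simp only [Set.mem_ofPred_eq] at *
    rw [Matrix.conjTranspose_smul, hA, star_trivial]

/-- The spinors `S₊ = K²`. -/
abbrev Spinor : Type _ := Fin 2 → K

variable {K}

/-- The real part. -/
def divRe : K →ₗ[ℝ] ℝ := NormedDivisionAlgebra.re

/-- The Minkowski metric `g`: the bilinear form obtained by polarizing
`g(A, A) = -det A = -(A₀₀ A₁₁ - |A₀₁|²)`. -/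
def minkowski : Vec K →ₗ[ℝ] Vec K →ₗ[ℝ] ℝ :=
  LinearMap.mk₂ ℝ
    (fun A B => divRe (A.1 0 1 * star (B.1 0 1)) -
      (divRe (A.1 0 0) * divRe (B.1 1 1) + divRe (A.1 1 1) * divRe (B.1 0 0)) / 2)
    (fun A A' B => by simp [add_mul]; ring)
    (fun c A B => by simp [smul_mul_assoc]; ring)
    (fun A B B' => by simp [mul_add]; ring)
    (fun c A B => by simp [mul_smul_comm]; ring)

/-- The trace reversal `A - (tr A) 1`. -/
def traceReversal : Vec K →ₗ[ℝ] Vec K where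
  toFun A := ⟨A.1 - Matrix.diagonal fun _ => A.1.trace, by
    have hA : A.1.conjTranspose = A.1 := A.2
    change Matrix.conjTranspose _ = _
    rw [Matrix.conjTranspose_sub, Matrix.diagonal_conjTranspose, hA]
    congr 2
    funext _
    change star A.1.trace = A.1.trace
    rw [← Matrix.trace_conjTranspose, hA]⟩
  map_add' A B := by
    apply Subtype.ext
    ext i j
    by_cases h : i = j <;> simp [h, Matrix.trace_add] <;> abel
  map_smul' c A := by
    apply Subtype.ext
    ext i j
    by_cases h : i = j <;> simp [h, Matrix.trace_smul, smul_sub]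

/-- The hermitian matrix `ψ φ† + φ ψ†`. -/
def spinorOuter : Spinor K →ₗ[ℝ] Spinor K →ₗ[ℝ] Vec K :=
  LinearMap.mk₂ ℝ
    (fun ψ φ => ⟨Matrix.vecMulVec ψ (star φ) + Matrix.vecMulVec φ (star ψ), by
      change Matrix.conjTranspose _ = _
      ext i j
      simp [Matrix.vecMulVec, add_comm]⟩)
    (fun ψ ψ' φ => by
      apply Subtype.ext; ext i j; simp [Matrix.vecMulVec, add_mul, mul_add]; abel)
    (fun c ψ φ => by
      apply Subtype.ext; ext i j
      simp [Matrix.vecMulVec, smul_mul_assoc, mul_smul_comm])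
    (fun ψ φ φ' => by
      apply Subtype.ext; ext i j; simp [Matrix.vecMulVec, add_mul, mul_add]; abel)
    (fun c ψ φ => by
      apply Subtype.ext; ext i j
      simp [Matrix.vecMulVec, smul_mul_assoc, mul_smul_comm])

/-- The bracket of spinors `ψ · φ`, the trace reversal of `ψ φ† + φ ψ†`. -/
def spinorBracket : Spinor K →ₗ[ℝ] Spinor K →ₗ[ℝ] Vec K :=
  spinorOuter.compr₂ traceReversal

theorem spinorBracket_comm (ψ φ : Spinor K) : spinorBracket ψ φ = spinorBracket φ ψ := by
  have : spinorOuter ψ φ = spinorOuter φ ψ := by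
    apply Subtype.ext
    simp [spinorOuter, add_comm]
  simp [spinorBracket, this]

theorem divRe_star (a : K) : divRe (star a) = divRe a := by
  have h1 := NormedDivisionAlgebra.add_star_eq a
  have h2 := NormedDivisionAlgebra.add_star_eq (star a)
  rw [star_star, add_comm, h1] at h2
  have := smul_left_injective ℝ (one_ne_zero (α := K)) h2
  simp only [divRe]
  linarith

theorem eq_divRe_smul_one {a : K} (h : star a = a) : a = divRe a • (1 : K) := by
  have h1 := NormedDivisionAlgebra.add_star_eq a
  rw [h, ← two_smul ℝ a, mul_smul] at h1
  exact smul_right_injective K (two_ne_zero (α := ℝ)) h1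

theorem minkowski_self (A : Vec K) :
    minkowski A A = -(divRe (A.1 0 0) * divRe (A.1 1 1) - divRe (A.1 0 1 * star (A.1 0 1))) := by
  simp [minkowski]; ring

theorem divRe_mul_star_comm (a b : K) : divRe (a * star b) = divRe (b * star a) := by
  rw [← divRe_star, star_mul, star_star]

theorem divRe_mul_comm (a b : K) : divRe (a * b) = divRe (b * a) := by
  have hb : star b = (2 * divRe b) • (1 : K) - b :=
    eq_sub_of_add_eq' (NormedDivisionAlgebra.add_star_eq b)
  have ha : star a = (2 * divRe a) • (1 : K) - a :=
    eq_sub_of_add_eq' (NormedDivisionAlgebra.add_star_eq a)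
  have h := divRe_mul_star_comm a b
  rw [ha, hb] at h
  simp only [mul_sub, mul_smul_comm, mul_one, map_sub, map_smul, smul_eq_mul] at h
  linarith

theorem divRe_mul_star_left (a b d : K) :
    divRe ((a * b) * star d) = divRe (b * star (star a * d)) := by
  have N := NormedDivisionAlgebra.normSq_mul (K := K)
  change ∀ a b : K, divRe ((a * b) * star (a * b)) = divRe (a * star a) * divRe (b * star b) at N
  have ha : star a = (2 * divRe a) • (1 : K) - a :=
    eq_sub_of_add_eq' (NormedDivisionAlgebra.add_star_eq a)
  have h1 := N (a + 1) (b + d)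
  have h2 := N (a + 1) b
  have h3 := N (a + 1) d
  have h4 := N a (b + d)
  have h5 := N a b
  have h6 := N a d
  have r1 : divRe (1 : K) = 1 := by
    have h := NormedDivisionAlgebra.add_star_eq (1 : K)
    rw [star_one, ← two_smul ℝ (1 : K)] at h
    have := smul_left_injective ℝ (one_ne_zero (α := K)) h
    simp only [divRe]
    linarith
  have ra := divRe_star a
  have c1 := divRe_mul_star_comm (a * b) d
  have c2 := divRe_mul_star_comm (a * d) b
  have c3 := divRe_mul_star_comm (a * b) (a * d)
  have c4 := divRe_mul_star_comm b d
  have c5 := divRe_mul_star_comm (a * b) b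
  have c6 := divRe_mul_star_comm (a * d) d
  have e : divRe (b * star (star a * d)) =
      2 * divRe a * divRe (b * star d) - divRe (b * star (a * d)) := by
    rw [ha, sub_mul, smul_mul_assoc, one_mul, star_sub, star_smul, mul_sub, map_sub,
      mul_smul_comm, map_smul]
    simp
  rw [e]
  simp only [add_mul, mul_add, one_mul, mul_one, star_add, star_one, map_add, ra, r1, ← c1, ← c2,
    ← c4, ← c5, ← c6] at h1 h2 h3 h4
  linarith

theorem divRe_mul_assoc (a b c : K) : divRe ((a * b) * c) = divRe (a * (b * c)) := by
  have key : ∀ a b c : K, divRe ((a * b) * c) = divRe ((c * a) * b) := by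
    intro a b c
    have h := divRe_mul_star_left a b (star c)
    rw [star_star, star_mul, star_star, star_star] at h
    rw [h, divRe_mul_comm]
  rw [key, key, divRe_mul_comm]

/-- The defining property of the bracket of spinors: `g(ψ · φ, A) = Re(ψ† (A φ))`. -/
theorem minkowski_spinorBracket (ψ φ : Spinor K) (A : Vec K) :
    minkowski (spinorBracket ψ φ) A = divRe (star ψ ⬝ᵥ A.1.mulVec φ) := by
  have hA : A.1.conjTranspose = A.1 := A.2
  have h10 : A.1 1 0 = star (A.1 0 1) := by
    conv_lhs => rw [← hA]
    rfl
  have h00 : A.1 0 0 = divRe (A.1 0 0) • (1 : K) := eq_divRe_smul_one (by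
    conv_rhs => rw [← hA]
    rfl)
  have h11 : A.1 1 1 = divRe (A.1 1 1) • (1 : K) := eq_divRe_smul_one (by
    conv_rhs => rw [← hA]
    rfl)
  have c : ∀ a b : K, divRe (a * star b) = divRe (star b * a) := fun a b => divRe_mul_comm _ _
  have t1 : divRe ((ψ 0 * star (φ 1)) * star (A.1 0 1)) =
      divRe (star (ψ 0) * (A.1 0 1 * φ 1)) := by
    rw [← divRe_star, star_mul, star_mul, star_star, star_star, ← divRe_mul_assoc, c]
  have t2 : divRe ((φ 0 * star (ψ 1)) * star (A.1 0 1)) =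
      divRe (star (ψ 1) * (star (A.1 0 1) * φ 0)) := by
    rw [divRe_mul_assoc, divRe_mul_comm, divRe_mul_assoc]
  have u0 := divRe_mul_star_comm (ψ 0) (φ 0)
  have u1 := divRe_mul_star_comm (ψ 1) (φ 1)
  have v0 := c (φ 0) (ψ 0)
  have v1 := c (φ 1) (ψ 1)
  simp only [Matrix.mulVec, dotProduct, Fin.sum_univ_two, h10, Pi.star_apply, map_add, mul_add]
  rw [← t1, ← t2]
  conv_rhs => rw [h00, h11]
  simp [minkowski, spinorBracket, spinorOuter, traceReversal, Matrix.vecMulVec,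
    Matrix.trace_fin_two, add_mul, smul_mul_assoc, mul_smul_comm]
  rw [u0, u1, v0, v1]
  ring

variable (K)

/-- The supertranslation algebra `T = V ⊕ S₊`. -/
abbrev SuperTranslation : Type _ := Vec K × Spinor K

/-- The vectors are even and the spinors are odd. -/
instance : SuperSpace (SuperTranslation K) where
  part a := if a = 0 then LinearMap.range (LinearMap.inl ℝ (Vec K) (Spinor K))
    else LinearMap.range (LinearMap.inr ℝ (Vec K) (Spinor K))
  isCompl := by simpa using LinearMap.isCompl_range_inl_inr

/-- `[(A, ψ), (B, φ)] = ψ · φ`. -/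
instance : LieSuperalgebra (SuperTranslation K) where
  bracket := (spinorBracket.compr₂ (LinearMap.inl ℝ (Vec K) (Spinor K))).compl₁₂
    (LinearMap.snd ℝ (Vec K) (Spinor K)) (LinearMap.snd ℝ (Vec K) (Spinor K))
  bracket_mem {a b x y} hx hy := by
    have hz : ∀ c : ZMod 2, c = 0 ∨ c = 1 := by decide
    obtain rfl | rfl : a = 0 ∨ a = 1 := hz a
    · obtain ⟨A, rfl⟩ := hx
      simp
    · obtain rfl | rfl : b = 0 ∨ b = 1 := hz b
      · obtain ⟨B, rfl⟩ := hy
        have : (0 : SuperTranslation K) ∈ SuperSpace.part (V := SuperTranslation K) (1 + 0) :=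
          Submodule.zero_mem _
        convert this using 1
        simp
      · exact ⟨_, rfl⟩
  bracket_skew {a b x y} hx hy := by
    have hz : ∀ c : ZMod 2, c = 0 ∨ c = 1 := by decide
    obtain rfl | rfl : a = 0 ∨ a = 1 := hz a
    · obtain ⟨A, rfl⟩ := hx
      simp
      rfl
    · obtain rfl | rfl : b = 0 ∨ b = 1 := hz b
      · obtain ⟨B, rfl⟩ := hy
        simp
      · have h : paritySign (1 * 1) = -1 := by decide
        rw [h]
        simp [spinorBracket_comm x.2 y.2]
  jacobi _ _ _ := by simp

variable {K}

/-- The `3`-cochain `α` on `T`: the unique super-skew-symmetric trilinear form with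
`α(ψ, φ, A) = g(ψ · φ, A)` that vanishes on homogeneous arguments unless one of them is a vector
and the other two are spinors. -/
def stringCocycle : MultilinearMap ℝ (fun _ : Fin 3 => SuperTranslation K) ℝ where
  toFun X := minkowski (spinorBracket (X 0).2 (X 1).2) (X 2).1 -
    minkowski (spinorBracket (X 0).2 (X 2).2) (X 1).1 +
    minkowski (spinorBracket (X 1).2 (X 2).2) (X 0).1
  map_update_add' := by
    intro inst x i u v
    have e : ∀ (k m : Fin 3) (w : SuperTranslation K), m ≠ k → Function.update x k w m = x m :=
      fun k m w h => Function.update_of_ne h w x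
    have e01 := fun w => e 0 1 w (by omega)
    have e02 := fun w => e 0 2 w (by omega)
    have e10 := fun w => e 1 0 w (by omega)
    have e12 := fun w => e 1 2 w (by omega)
    have e20 := fun w => e 2 0 w (by omega)
    have e21 := fun w => e 2 1 w (by omega)
    obtain rfl | rfl | rfl : i = 0 ∨ i = 1 ∨ i = 2 := by omega
    all_goals
      simp only [Function.update_self, e01, e02, e10, e12, e20, e21, Prod.fst_add, Prod.snd_add, Prod.smul_fst, Prod.smul_snd,
        map_add, map_smul, LinearMap.add_apply, LinearMap.smul_apply, smul_eq_mul]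
      ring
  map_update_smul' := by
    intro inst x i c u
    have e : ∀ (k m : Fin 3) (w : SuperTranslation K), m ≠ k → Function.update x k w m = x m :=
      fun k m w h => Function.update_of_ne h w x
    have e01 := fun w => e 0 1 w (by omega)
    have e02 := fun w => e 0 2 w (by omega)
    have e10 := fun w => e 1 0 w (by omega)
    have e12 := fun w => e 1 2 w (by omega)
    have e20 := fun w => e 2 0 w (by omega)
    have e21 := fun w => e 2 1 w (by omega)
    obtain rfl | rfl | rfl : i = 0 ∨ i = 1 ∨ i = 2 := by omega
    all_goals
      simp only [Function.update_self, e01, e02, e10, e12, e20, e21, Prod.fst_add, Prod.snd_add, Prod.smul_fst, Prod.smul_snd,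
        map_add, map_smul, LinearMap.add_apply, LinearMap.smul_apply, smul_eq_mul]
      ring

theorem stringCocycle_spinor_spinor_vector (ψ φ : Spinor K) (A : Vec K) :
    stringCocycle ![((0, ψ) : SuperTranslation K), (0, φ), (A, 0)] =
      minkowski (spinorBracket ψ φ) A := by
  simp [stringCocycle]

end Spacetime

/-!
The three-form `α` twists the Lie superalgebra `T` into a Lie 2-superalgebra on `T ⊕ ℝ`, with
brackets `l₂ = [·,·]` and `l₃ = α`. As `l₂` and `l₃` are the only nonzero brackets and only take
arguments in degree `0`, the one Jacobi identity beyond that of `T` has four arguments; written as a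
sum over `(2,2)`-unshuffles it says `dα = 0`.

In `dα` only four spinors can contribute, and what remains is the cyclic sum of
`g(ψ₀ · ψ₁, ψ₂ · ψ₃)`. This is the polarization of the quartic form `g(ψ · ψ, ψ · ψ)`, and
`ψ · ψ` is a null vector because the norm of `K` is multiplicative.

Two quadruples of the same L∞-superalgebra are related by a homomorphism of Lie superalgebras and an
equivariant map of coefficients along which cocycles and coboundaries pull back, so exactness may be
tested on `(T, ℝ, 0, α)`. There, `dθ(ψ, φ, ψ · φ) = ±θ(ψ · φ, ψ · φ) = 0` for every 2-cochain `θ`,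
as vectors are central and even, whereas `α(ψ, φ, ψ · φ) = g(ψ · φ, ψ · φ)` is not identically zero.
-/

theorem parity_eq_zero_or_one (c : ZMod 2) : c = 0 ∨ c = 1 := by
  revert c; decide

theorem paritySign_add (a b : ZMod 2) : paritySign (a + b) = paritySign a * paritySign b := by
  revert a b; decide

theorem paritySign_mul_self (a : ZMod 2) : paritySign a * paritySign a = 1 := by
  revert a; decide

theorem paritySign_sum {ι : Type*} (s : Finset ι) (d : ι → ZMod 2) :
    paritySign (∑ i ∈ s, d i) = ∏ i ∈ s, paritySign (d i) := by
  classical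
  induction s using Finset.induction_on with
  | empty => rfl
  | insert i s hi ih => rw [Finset.sum_insert hi, Finset.prod_insert hi, paritySign_add, ih]

theorem prod_prod_lt_comp_perm {ι M : Type*} [Fintype ι] [LinearOrder ι] [CommMonoid M]
    (τ : Equiv.Perm ι) {f : ι → ι → M} (hf : ∀ i j, f i j = f j i) :
    ∏ i, ∏ j, (if i < j then f (τ i) (τ j) else 1) = ∏ i, ∏ j, if i < j then f i j else 1 := by
  have split (i j : ι) : (if τ.symm i < τ.symm j then f i j else 1) =
      (if i < j ∧ τ.symm i < τ.symm j then f i j else 1) *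
        if j < i ∧ τ.symm i < τ.symm j then f j i else 1 := by
    rcases lt_trichotomy i j with h | rfl | h
    · simp [h, h.not_gt]
    · simp
    · simp [h, h.not_gt, hf i j]
  have merge (i j : ι) : (if i < j ∧ τ.symm i < τ.symm j then f i j else 1) *
      (if i < j ∧ τ.symm j < τ.symm i then f i j else 1) = if i < j then f i j else 1 := by
    by_cases h : i < j
    · rcases lt_or_gt_of_ne (τ.symm.injective.ne h.ne) with h' | h' <;> simp [h, h', h'.not_gt]
    · simp [h]
  calc ∏ i, ∏ j, (if i < j then f (τ i) (τ j) else 1)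
      = ∏ i, ∏ j, if τ.symm i < τ.symm j then f i j else 1 := by
        rw [← Equiv.prod_comp τ (fun i => ∏ j, if τ.symm i < τ.symm j then f i j else 1)]
        refine Finset.prod_congr rfl fun i _ => ?_
        rw [← Equiv.prod_comp τ (fun j => if τ.symm (τ i) < τ.symm j then f (τ i) j else 1)]
        simp only [Equiv.symm_apply_apply]
    _ = _ := by
        simp only [split, Finset.prod_mul_distrib]
        rw [Finset.prod_comm (f := fun i j => if j < i ∧ τ.symm i < τ.symm j then f j i else 1)]
        simp only [← Finset.prod_mul_distrib, merge]

theorem chiSign_eq_prod {n : ℕ} (σ : Equiv.Perm (Fin n)) (d : Fin n → ZMod 2) :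
    chiSign σ d =
      ∏ i, ∏ j, if i < j ∧ σ j < σ i then -paritySign (d (σ i) * d (σ j)) else 1 := by
  have sign_eq : (Equiv.Perm.sign σ : ℤ) = ∏ i, ∏ j, if i < j ∧ σ j < σ i then -1 else 1 := by
    rw [Equiv.Perm.sign_eq_prod_prod_Ioi, Units.coe_prod]
    refine Finset.prod_congr rfl fun i _ => ?_
    rw [Units.coe_prod, ← Finset.filter_lt_eq_Ioi, Finset.prod_filter]
    refine Finset.prod_congr rfl fun j _ => ?_
    rcases lt_or_ge (σ i) (σ j) with h | h
    · simp [h, h.not_gt]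
    · by_cases hij : i < j
      · simp [hij, h.not_gt, h.lt_of_ne (σ.injective.ne hij.ne')]
      · simp [hij]
  rw [chiSign, koszulSign, sign_eq]
  simp only [← Finset.prod_mul_distrib]
  refine Finset.prod_congr rfl fun i _ => Finset.prod_congr rfl fun j _ => ?_
  split_ifs <;> simp

theorem chiSign_mul {n : ℕ} (σ τ : Equiv.Perm (Fin n)) (d : Fin n → ZMod 2) :
    chiSign (σ * τ) d = chiSign σ d * chiSign τ (d ∘ σ) := by
  let f (i j : Fin n) : ℤ := if i < j ∧ σ j < σ i ∨ j < i ∧ σ i < σ j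
    then -paritySign (d (σ i) * d (σ j)) else 1
  have f_comm (i j : Fin n) : f i j = f j i := by
    simp only [f, or_comm, mul_comm (d (σ i))]
  have hσ : chiSign σ d = ∏ i, ∏ j, if i < j then f i j else 1 := by
    rw [chiSign_eq_prod]
    refine Finset.prod_congr rfl fun i _ => Finset.prod_congr rfl fun j _ => ?_
    by_cases h : i < j
    · simp [f, h, h.not_gt]
    · simp [h]
  rw [hσ, ← prod_prod_lt_comp_perm τ f_comm, chiSign_eq_prod, chiSign_eq_prod]
  simp only [← Finset.prod_mul_distrib]
  refine Finset.prod_congr rfl fun i _ => Finset.prod_congr rfl fun j _ => ?_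
  by_cases hij : i < j
  · have hsq := paritySign_mul_self (d (σ (τ i)) * d (σ (τ j)))
    have hτ : τ i ≠ τ j := τ.injective.ne hij.ne
    rcases lt_or_gt_of_ne hτ with h | h <;>
      rcases lt_or_gt_of_ne (σ.injective.ne hτ) with h' | h' <;>
      simp [f, hij, h, h', h.not_gt, h'.not_gt, hsq]
  · simp [hij]

theorem chiSign_swap_castSucc_succ {n : ℕ} (i : Fin n) (d : Fin (n + 1) → ZMod 2) :
    chiSign (Equiv.swap i.castSucc i.succ) d = -paritySign (d i.castSucc * d i.succ) := by
  have inversion_iff (a b : Fin (n + 1)) :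
      a < b ∧ Equiv.swap i.castSucc i.succ b < Equiv.swap i.castSucc i.succ a ↔
        a = i.castSucc ∧ b = i.succ := by
    simp only [Equiv.swap_apply_def, Fin.ext_iff]
    split_ifs <;> simp only [Fin.lt_def, Fin.val_castSucc, Fin.val_succ] at * <;> omega
  simp [chiSign_eq_prod, inversion_iff, ite_and, Finset.prod_ite_irrel, mul_comm]

theorem chiSign_one {n : ℕ} (d : Fin n → ZMod 2) : chiSign 1 d = 1 := by
  rw [chiSign_eq_prod]
  exact Finset.prod_eq_one fun i _ => Finset.prod_eq_one fun j _ =>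
    if_neg fun h => lt_asymm h.1 h.2

theorem isCochain_of_swap_castSucc_succ {L R : Type*} [AddCommGroup L] [Module ℝ L] [SuperSpace L]
    [AddCommGroup R] [Module ℝ R] {n : ℕ} {ω : MultilinearMap ℝ (fun _ : Fin (n + 1) => L) R}
    (h : ∀ (i : Fin n) (a : Fin (n + 1) → ZMod 2) (x : Fin (n + 1) → L),
      (∀ k, x k ∈ SuperSpace.part (a k)) → ω (x ∘ Equiv.swap i.castSucc i.succ) =
        -(paritySign (a i.castSucc * a i.succ) • ω x)) : IsCochain ω := by
  intro σ
  have hσ : σ ∈ Submonoid.closure (Set.range fun i : Fin n => Equiv.swap i.castSucc i.succ) := by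
    rw [Equiv.Perm.mclosure_swap_castSucc_succ]
    exact Submonoid.mem_top σ
  induction hσ using Submonoid.closure_induction with
  | mem σ hσ =>
    obtain ⟨i, rfl⟩ := hσ
    intro a x hx
    rw [h i a x hx, chiSign_swap_castSucc_succ, neg_smul]
  | one => intro a x _; simp [chiSign_one]
  | mul σ τ _ _ ihσ ihτ =>
    intro a x hx
    rw [Equiv.Perm.coe_mul, ← Function.comp_assoc, ihτ (a ∘ σ) (x ∘ σ) fun i => hx (σ i),
      ihσ a x hx, smul_smul, mul_comm, chiSign_mul]

theorem prod_lt_neg_paritySign {n : ℕ} (d : Fin n → ZMod 2) (u : Fin n) :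
    ∏ v, (if v < u then -paritySign (d u * d v) else 1) = (-1) ^ (u : ℕ) * frontSign d u := by
  rw [frontSign, Finset.mul_sum, paritySign_sum, ← Finset.prod_filter, Finset.prod_neg,
    Finset.filter_gt_eq_Iio, Fin.card_Iio]

theorem chiSign_of_isUnshuffle_two {n : ℕ} {σ : Equiv.Perm (Fin (n + 2))} (hσ : IsUnshuffle 2 σ)
    (d : Fin (n + 2) → ZMod 2) :
    chiSign σ d = -((-1) ^ ((σ 0 : ℕ) + (σ 1 : ℕ)) * paritySign (d (σ 0) * d (σ 1)) *
      frontSign d (σ 0) * frontSign d (σ 1)) := by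
  let c (u v : Fin (n + 2)) : ℤ := -paritySign (d u * d v)
  let row (i : Fin (n + 2)) : ℤ := ∏ j, if i < j ∧ σ j < σ i then c (σ i) (σ j) else 1
  have h01 : σ 0 < σ 1 := hσ 0 1 (by simp) (Or.inl (by simp))
  have row_zero : row 0 = (-1) ^ (σ 0 : ℕ) * frontSign d (σ 0) := by
    rw [← prod_lt_neg_paritySign,
      ← Equiv.prod_comp σ fun v => if v < σ 0 then c (σ 0) v else 1]
    refine Finset.prod_congr rfl fun j _ => ?_
    rcases eq_or_ne j 0 with rfl | hj
    · simp only [lt_irrefl, false_and]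
    · simp only [Fin.pos_iff_ne_zero.2 hj, true_and]
  -- The factor missing from this row is the pair `(0, 1)`, which is not an inversion.
  have row_one : row 1 * c (σ 1) (σ 0) = (-1) ^ (σ 1 : ℕ) * frontSign d (σ 1) := by
    rw [← prod_lt_neg_paritySign, ← Equiv.prod_comp σ fun v => if v < σ 1 then c (σ 1) v else 1,
      ← Fintype.prod_ite_eq 0 fun j => c (σ 1) (σ j), ← Finset.prod_mul_distrib]
    refine Finset.prod_congr rfl fun j _ => ?_
    refine Fin.cases ?_ (Fin.cases ?_ fun j => ?_) j
    · simp [h01]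
    · simp
    · have : (1 : Fin (n + 2)) < j.succ.succ := Fin.succ_lt_succ_iff.2 (Fin.succ_pos j)
      simp [this, (Fin.succ_ne_zero _).symm]
  have row_succ_succ (i : Fin n) : row i.succ.succ = 1 :=
    Finset.prod_eq_one fun j _ => if_neg fun h => h.2.not_gt (hσ _ _ h.1 (Or.inr (by simp)))
  have c_sq : c (σ 1) (σ 0) * c (σ 1) (σ 0) = 1 := by
    rw [neg_mul_neg, paritySign_mul_self]
  calc chiSign σ d
      = ∏ i, row i := chiSign_eq_prod σ d
    _ = row 0 * row 1 := by
        rw [Fin.prod_univ_succ, Fin.prod_univ_succ, Finset.prod_eq_one fun i _ => row_succ_succ i,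
          mul_one, Fin.succ_zero_eq_one]
    _ = c (σ 1) (σ 0) * row 0 * (row 1 * c (σ 1) (σ 0)) := by
        linear_combination -row 0 * row 1 * c_sq
    _ = _ := by
        rw [row_zero, row_one, mul_comm (d (σ 0))]
        ring

/-- The `(2, n)`-unshuffle that brings the places `i < j` to the front; omitting first `j` and then
`i` makes `i` range over `Fin (n + 1)`. -/
noncomputable def twoUnshuffle {n : ℕ} (i : Fin (n + 1)) (j : Fin (n + 2)) :
    Equiv.Perm (Fin (n + 2)) :=
  Equiv.ofBijective
    (Fin.cons (j.succAbove i) (Fin.cons j fun k => j.succAbove (i.succAbove k)))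
    (Finite.injective_iff_bijective.1 (by
      simpa [Fin.cons_injective_iff, Function.comp_def] using
        (Fin.succAbove_right_injective (p := j)).comp Fin.succAbove_right_injective))

section TwoUnshuffle

variable {n : ℕ}

theorem twoUnshuffle_zero {i : Fin (n + 1)} {j : Fin (n + 2)} (h : i.castSucc < j) :
    twoUnshuffle i j 0 = i.castSucc :=
  Fin.succAbove_of_castSucc_lt j i h

theorem twoUnshuffle_one (i : Fin (n + 1)) (j : Fin (n + 2)) : twoUnshuffle i j 1 = j :=
  rfl

theorem twoUnshuffle_succ_succ (i : Fin (n + 1)) (j : Fin (n + 2)) (k : Fin n) :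
    twoUnshuffle i j k.succ.succ = j.succAbove (i.succAbove k) :=
  rfl

theorem isUnshuffle_twoUnshuffle {i : Fin (n + 1)} {j : Fin (n + 2)} (h : i.castSucc < j) :
    IsUnshuffle 2 (twoUnshuffle i j) := by
  intro a b
  refine Fin.cases ?_ (Fin.cases ?_ fun a => ?_) a <;>
    refine Fin.cases ?_ (Fin.cases ?_ fun b => ?_) b <;>
    simp [twoUnshuffle_zero h, twoUnshuffle_one, twoUnshuffle_succ_succ, h]

theorem range_comp_succ_succ (σ : Equiv.Perm (Fin (n + 2))) :
    Set.range (fun k : Fin n => σ k.succ.succ) = {σ 0, σ 1}ᶜ := by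
  ext m
  obtain ⟨m, rfl⟩ := σ.surjective m
  refine Fin.cases ?_ (Fin.cases ?_ fun a => ?_) m <;> simp [Fin.ext_iff]

theorem IsUnshuffle.ext_two {σ τ : Equiv.Perm (Fin (n + 2))} (hσ : IsUnshuffle 2 σ)
    (hτ : IsUnshuffle 2 τ) (h0 : σ 0 = τ 0) (h1 : σ 1 = τ 1) : σ = τ := by
  have tail_strictMono {σ : Equiv.Perm (Fin (n + 2))} (hσ : IsUnshuffle 2 σ) :
      StrictMono fun k : Fin n => σ k.succ.succ :=
    fun a b hab => hσ _ _ (by simpa using hab) (Or.inr (by simp))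
  have tail : (fun k : Fin n => σ k.succ.succ) = fun k => τ k.succ.succ := by
    rw [← (tail_strictMono hσ).range_inj (tail_strictMono hτ), range_comp_succ_succ,
      range_comp_succ_succ, h0, h1]
  ext m : 1
  exact Fin.cases h0 (Fin.cases h1 (congrFun tail)) m

theorem sum_isUnshuffle_two {M : Type*} [AddCommMonoid M] (f : Equiv.Perm (Fin (n + 2)) → M) :
    ∑ σ ∈ Finset.univ.filter (IsUnshuffle (n := n + 2) 2), f σ =
      ∑ i : Fin (n + 1), ∑ j : Fin (n + 2),
        if i.castSucc < j then f (twoUnshuffle i j) else 0 := by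
  rw [← Fintype.sum_prod_type', ← Finset.sum_filter]
  symm
  refine Finset.sum_bij (fun p _ => twoUnshuffle p.1 p.2) ?_ ?_ ?_ fun _ _ => rfl
  · simpa using fun i j => isUnshuffle_twoUnshuffle
  · rintro ⟨i, j⟩ hij ⟨i', j'⟩ hij' h
    simp only [Finset.mem_filter_univ] at hij hij'
    have h0 := congrArg (· 0) h
    have h1 := congrArg (· 1) h
    simp only [twoUnshuffle_zero hij, twoUnshuffle_zero hij', twoUnshuffle_one,
      Fin.castSucc_inj] at h0 h1
    exact Prod.ext h0 h1
  · intro σ hσ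
    rw [Finset.mem_filter_univ] at hσ
    have h01 : σ 0 < σ 1 := hσ 0 1 (by simp) (Or.inl (by simp))
    obtain ⟨i, hi⟩ := Fin.exists_castSucc_eq.2 h01.ne_top
    rw [← hi] at h01
    refine ⟨(i, σ 1), by simpa using h01, ?_⟩
    exact (isUnshuffle_twoUnshuffle h01).ext_two hσ ((twoUnshuffle_zero h01).trans hi)
      (twoUnshuffle_one _ _)

end TwoUnshuffle

theorem sum_isUnshuffle_two_bracket {L R : Type*} [AddCommGroup L] [Module ℝ L] [SuperSpace L]
    [LieSuperalgebra L] [AddCommGroup R] [Module ℝ R] {n : ℕ}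
    (ω : MultilinearMap ℝ (fun _ : Fin (n + 1) => L) R) (a : Fin (n + 2) → ZMod 2)
    (X : Fin (n + 2) → L) :
    ∑ σ ∈ Finset.univ.filter (IsUnshuffle (n := n + 2) 2),
      chiSign σ a • ω (Fin.cons (LieSuperalgebra.bracket (X (σ 0)) (X (σ 1)))
        fun k => X (σ k.succ.succ)) = -coboundaryBracketPart ω a X := by
  rw [sum_isUnshuffle_two, coboundaryBracketPart, ← Finset.sum_neg_distrib]
  refine Finset.sum_congr rfl fun i _ => ?_
  rw [← Finset.sum_neg_distrib]
  refine Finset.sum_congr rfl fun j _ => ?_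
  split_ifs with h
  · rw [chiSign_of_isUnshuffle_two (isUnshuffle_twoUnshuffle h), neg_smul]
    simp only [twoUnshuffle_zero h, twoUnshuffle_one, twoUnshuffle_succ_succ, Fin.val_castSucc]
  · rw [neg_zero]

theorem coboundary_trivial {L R : Type*} [AddCommGroup L] [Module ℝ L] [SuperSpace L]
    [LieSuperalgebra L] [AddCommGroup R] [Module ℝ R] [SuperSpace R] {n : ℕ} (c : ZMod 2)
    (ω : MultilinearMap ℝ (fun _ : Fin n => L) R) (a : Fin (n + 1) → ZMod 2)
    (X : Fin (n + 1) → L) :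
    coboundary (SuperRep.trivial L R) c ω a X = coboundaryBracketPart ω a X := by
  simp [coboundary, SuperRep.trivial]

theorem isInternal_prod {ι S M N : Type*} [DecidableEq ι] [Ring S] [AddCommGroup M] [Module S M]
    [AddCommGroup N] [Module S N] {A : ι → Submodule S M} {B : ι → Submodule S N}
    (hA : DirectSum.IsInternal A) (hB : DirectSum.IsInternal B) :
    DirectSum.IsInternal fun i => (A i).prod (B i) := by
  rw [DirectSum.isInternal_submodule_iff_iSupIndep_and_iSup_eq_top] at *
  constructor
  · intro i
    have h : ⨆ (j) (_ : j ≠ i), (A j).prod (B j) ≤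
        (⨆ (j) (_ : j ≠ i), A j).prod (⨆ (j) (_ : j ≠ i), B j) :=
      iSup₂_le fun j hj => Submodule.prod_mono (le_iSup₂_of_le j hj le_rfl)
        (le_iSup₂_of_le j hj le_rfl)
    refine Disjoint.mono_right h (Submodule.disjoint_def.2 fun x hx hx' => ?_)
    exact Prod.ext (Submodule.disjoint_def.1 (hA.1 i) _ hx.1 hx'.1)
      (Submodule.disjoint_def.1 (hB.1 i) _ hx.2 hx'.2)
  · rw [eq_top_iff, ← LinearMap.sup_range_inl_inr, LinearMap.range_eq_map, LinearMap.range_eq_map,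
      ← hA.2, ← hB.2, Submodule.map_iSup, Submodule.map_iSup]
    refine sup_le (iSup_mono fun i => ?_) (iSup_mono fun i => ?_)
    · rintro _ ⟨x, hx, rfl⟩
      exact ⟨hx, Submodule.zero_mem _⟩
    · rintro _ ⟨x, hx, rfl⟩
      exact ⟨Submodule.zero_mem _, hx⟩

theorem fst_comp_cons {M N : Type*} {n : ℕ} (z : M × N) (y : Fin n → M × N) :
    (fun i => (Fin.cons (α := fun _ => M × N) z y i).1) =
      Fin.cons (α := fun _ => M) z.1 fun i => (y i).1 :=
  Fin.comp_cons Prod.fst z y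

namespace LInftySuperalgebra

section SingleGrading

variable {V : Type*} [AddCommGroup V] [Module ℝ V] [SuperSpace V] {n : ℕ} {p : ℤ} {a : ZMod 2}

theorem singleGrading_self : singleGrading V n n a = SuperSpace.part a :=
  if_pos rfl

theorem singleGrading_of_ne (hp : p ≠ n) (a : ZMod 2) : singleGrading V n p a = ⊥ :=
  if_neg hp

theorem mem_part_of_mem_singleGrading {x : V} (hx : x ∈ singleGrading V 0 p a) :
    x ∈ SuperSpace.part ((p : ZMod 2) + a) := by
  rcases eq_or_ne p 0 with rfl | hp
  · simpa [singleGrading] using hx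
  · rw [singleGrading_of_ne (mod_cast hp), Submodule.mem_bot] at hx
    exact hx ▸ Submodule.zero_mem _

end SingleGrading

section SingleBracket

variable {L R : Type*} [AddCommGroup L] [Module ℝ L] [AddCommGroup R] [Module ℝ R] {n : ℕ}

/-- The family of brackets with `ω` in its own arity and zero in all others. -/
def singleBracket (ω : MultilinearMap ℝ (fun _ : Fin n => L) R) :
    ∀ k : ℕ, MultilinearMap ℝ (fun _ : Fin k => L) R :=
  Pi.single n ω

theorem singleBracket_self (ω : MultilinearMap ℝ (fun _ : Fin n => L) R) :
    singleBracket ω n = ω := by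
  simp [singleBracket]

theorem singleBracket_of_ne (ω : MultilinearMap ℝ (fun _ : Fin n => L) R) {k : ℕ} (hk : k ≠ n) :
    singleBracket ω k = 0 := by
  simp [singleBracket, hk]

variable [SuperSpace L]

theorem singleBracket_antisymm {ω : MultilinearMap ℝ (fun _ : Fin n => L) R} (hω : IsCochain ω)
    {k : ℕ} (σ : Equiv.Perm (Fin k)) (d : Fin k → ZMod 2) (x : Fin k → L)
    (hx : ∀ i, x i ∈ SuperSpace.part (d i)) :
    singleBracket ω k (x ∘ σ) = chiSign σ d • singleBracket ω k x := by
  rcases ne_or_eq k n with hk | rfl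
  · rw [singleBracket_of_ne ω hk, zero_apply, zero_apply, smul_zero]
  · rw [singleBracket_self]
    exact hω σ d x hx

variable [SuperSpace R]

theorem singleBracket_mem_singleGrading {ω : MultilinearMap ℝ (fun _ : Fin (n + 2) => L) R}
    (hω : HasParity 0 ω) (k : ℕ) (p : Fin k → ℤ) (a : Fin k → ZMod 2) (x : Fin k → L)
    (hx : ∀ i, x i ∈ singleGrading L 0 (p i) (a i)) :
    singleBracket ω k x ∈ singleGrading R n (∑ i, p i + k - 2) (∑ i, a i) := by
  rcases ne_or_eq k (n + 2) with hk | rfl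
  · rw [singleBracket_of_ne ω hk]
    exact Submodule.zero_mem _
  rw [singleBracket_self]
  by_cases hp : ∀ i, p i = 0
  · simp only [hp, singleGrading, Nat.cast_zero, if_true] at hx
    simpa [hp, singleGrading] using hω a x hx
  · push Not at hp
    obtain ⟨i, hi⟩ := hp
    have hxi := hx i
    rw [singleGrading_of_ne (mod_cast hi), Submodule.mem_bot] at hxi
    rw [ω.map_coord_zero i hxi]
    exact Submodule.zero_mem _

end SingleBracket

section OfCocycle

variable {L R : Type*} [AddCommGroup L] [Module ℝ L] [SuperSpace L] [LieSuperalgebra L]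
  [AddCommGroup R] [Module ℝ R] {n : ℕ}

/-- The brackets on `L × R` whose first component is the Lie bracket of `L` and whose second
component is `ω`, placed in its own arity. They only involve the components in `L`. -/
def cocycleBrackets (ω : MultilinearMap ℝ (fun _ : Fin n => L) R) (k : ℕ) :
    MultilinearMap ℝ (fun _ : Fin k => L × R) (L × R) :=
  ((lieBrackets L k).prod (singleBracket ω k)).compLinearMap fun _ => LinearMap.fst ℝ L R

theorem cocycleBrackets_apply (ω : MultilinearMap ℝ (fun _ : Fin n => L) R) (k : ℕ)
    (x : Fin k → L × R) :
    cocycleBrackets ω k x =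
      (lieBrackets L k fun i => (x i).1, singleBracket ω k fun i => (x i).1) :=
  rfl

variable [SuperSpace R]

-- Only the summand `i = 2`, `N = n + 3` survives, and there the sum is `-dω`.
theorem singleBracket_jacobi {ω : MultilinearMap ℝ (fun _ : Fin (n + 2) => L) R}
    (hω : IsEvenCocycle (SuperRep.trivial L R) ω) (N : ℕ) (d : Fin N → ZMod 2)
    (x : Fin N → L) (hx : ∀ i, x i ∈ SuperSpace.part (d i)) :
    ∑ i : Fin (N + 1), (if (i : ℕ) = 0 then 0 else
        ∑ σ ∈ Finset.univ.filter (IsUnshuffle (n := N) i),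
          (chiSign σ d * (-1) ^ ((i : ℕ) * (N - (i : ℕ))) : ℤ) •
            singleBracket ω (N - (i : ℕ) + 1)
              (Fin.cons (lieBrackets L i fun m : Fin (i : ℕ) => x (σ ⟨m, by omega⟩))
                fun m : Fin (N - (i : ℕ)) => x (σ ⟨(i : ℕ) + m, by omega⟩))) = 0 := by
  refine Finset.sum_eq_zero fun i _ => ?_
  by_cases hi : (i : ℕ) = 2
  · by_cases hN : N = n + 3
    · subst hN
      obtain ⟨_, h2⟩ := i
      obtain rfl : _ = 2 := hi
      have closed := hω.closed d x hx
      rw [coboundary_trivial, ← neg_eq_zero, ← sum_isUnshuffle_two_bracket] at closed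
      rw [if_neg two_ne_zero, ← closed]
      refine Finset.sum_congr rfl fun σ _ => ?_
      have index (k : Fin (n + 1)) (h : 2 + (k : ℕ) < n + 3) : ⟨2 + k, h⟩ = k.succ.succ :=
        Fin.ext (by simp; omega)
      simp only [pow_mul, neg_one_sq, one_pow, mul_one]
      change chiSign σ d • singleBracket ω (n + 2) _ = _
      rw [singleBracket_self]
      congr 2
      simp only [index]
      rfl
    · rw [if_neg (by omega)]
      refine Finset.sum_eq_zero fun σ _ => ?_
      rw [singleBracket_of_ne ω (by omega), zero_apply, smul_zero]
  · split_ifs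
    · rfl
    · refine Finset.sum_eq_zero fun σ _ => ?_
      rw [MultilinearMap.map_coord_zero _ 0, smul_zero]
      rw [Fin.cons_zero, lieBrackets_ne L hi, zero_apply]

/-- The L∞-superalgebra on `L × R`, with `L` in degree `0` and `R` in degree `n`, of a quadruple
`(L, R, 0, ω)`. -/
def ofCocycle (ω : MultilinearMap ℝ (fun _ : Fin (n + 2) => L) R)
    (hω : IsEvenCocycle (SuperRep.trivial L R) ω) : LInftySuperalgebra (L × R) where
  gr p a := (singleGrading L 0 p a).prod (singleGrading R n p a)
  internal := isInternal_prod (singleGrading_isInternal L 0) (singleGrading_isInternal R n)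
  gr_neg p a hp := by
    rw [singleGrading_of_ne (by omega), singleGrading_of_ne (by omega), Submodule.prod_bot]
  l := cocycleBrackets ω
  l_zero := by
    rw [cocycleBrackets, lieBrackets_ne L (by simp), singleBracket_of_ne ω (by simp)]
    rfl
  l_mem k p a x hx :=
    ⟨(ofLie L).l_mem k p a (fun i => (x i).1) fun i => (hx i).1,
      singleBracket_mem_singleGrading hω.even k p a (fun i => (x i).1) fun i => (hx i).1⟩
  antisymm k σ p a x hx :=
    Prod.ext ((ofLie L).antisymm k σ p a (fun i => (x i).1) fun i => (hx i).1)
      (singleBracket_antisymm hω.isCochain σ _ (fun i => (x i).1)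
        fun i => mem_part_of_mem_singleGrading (hx i).1)
  jacobi N p a x hx := by
    refine Prod.ext (Eq.trans ?_ ((ofLie L).jacobi N p a (fun i => (x i).1) fun i => (hx i).1))
      (Eq.trans ?_ (singleBracket_jacobi hω N _ (fun i => (x i).1)
        fun i => mem_part_of_mem_singleGrading (hx i).1))
    · simp only [Prod.fst_sum, apply_ite Prod.fst, Prod.smul_fst, cocycleBrackets_apply,
        fst_comp_cons]
      rfl
    · simp only [Prod.snd_sum, apply_ite Prod.snd, Prod.smul_snd, cocycleBrackets_apply,
        fst_comp_cons]
      rfl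

variable (ω : MultilinearMap ℝ (fun _ : Fin (n + 2) => L) R)
  (hω : IsEvenCocycle (SuperRep.trivial L R) ω)

theorem ofCocycle_correspondsTo (hn : 0 < n) :
    (ofCocycle ω hω).CorrespondsTo (SuperRep.trivial L R) ω := by
  have gr_eq (p : ℤ) (a : ZMod 2) : (ofCocycle ω hω).gr p a =
      (singleGrading L 0 p a).prod (singleGrading R n p a) := rfl
  have l_eq : (ofCocycle ω hω).l = cocycleBrackets ω := rfl
  refine ⟨hn, hω, fun p a h0 h1 => ?_, ?_, LinearMap.inl ℝ L R, LinearMap.inr ℝ L R,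
    LinearMap.inl_injective, LinearMap.inr_injective, fun a => ?_, fun a => ?_, fun x y => ?_,
    fun x v => ?_, fun x => ?_⟩
  · rw [gr_eq, singleGrading_of_ne (by simpa using h0), singleGrading_of_ne h1,
      Submodule.prod_bot]
  · rw [l_eq, cocycleBrackets, lieBrackets_ne L (by simp), singleBracket_of_ne ω (by omega)]
    rfl
  · rw [gr_eq, singleGrading_of_ne (n := n) (by omega), Submodule.map_inl]
    simp [singleGrading]
  · rw [gr_eq, singleGrading_of_ne (by omega), singleGrading_self, Submodule.map_inr]
  · rw [l_eq, cocycleBrackets_apply, singleBracket_of_ne ω (by omega)]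
    rfl
  · rw [l_eq, cocycleBrackets_apply, singleBracket_of_ne ω (by omega)]
    exact Prod.ext (map_zero (LieSuperalgebra.bracket x)) rfl
  · rw [l_eq, cocycleBrackets_apply, lieBrackets_ne L (by omega), singleBracket_self]
    rfl

theorem ofCocycle_isExtension : (ofCocycle ω hω).IsExtension L R n := by
  refine ⟨⟨LinearMap.inr ℝ L R, fun p a x hx => ⟨Submodule.zero_mem _, hx⟩, fun k x => ?_⟩,
    ⟨LinearMap.fst ℝ L R, fun p a x hx => hx.1, fun k x => rfl⟩,
    LinearMap.inr_injective, Function.Exact.inr_fst, LinearMap.fst_surjective⟩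
  change LinearMap.inr ℝ L R 0 = (ofCocycle ω hω).l k fun i => LinearMap.inr ℝ L R (x i)
  rcases k with _ | k
  · rw [(ofCocycle ω hω).l_zero, map_zero, zero_apply]
  · change _ = cocycleBrackets ω (k + 1) _
    rw [map_zero, cocycleBrackets_apply, MultilinearMap.map_coord_zero _ 0 rfl,
      MultilinearMap.map_coord_zero _ 0 rfl]
    rfl

end OfCocycle

theorem CorrespondsTo.isLie {W g R : Type*} [AddCommGroup W] [Module ℝ W] [AddCommGroup g]
    [Module ℝ g] [SuperSpace g] [LieSuperalgebra g] [AddCommGroup R] [Module ℝ R] [SuperSpace R]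
    {n : ℕ} {A : LInftySuperalgebra W} {ρ : SuperRep g R}
    {ω : MultilinearMap ℝ (fun _ : Fin (n + 2) => g) R} (h : A.CorrespondsTo ρ ω) :
    A.IsLie (n + 1) :=
  fun p a hp => h.2.2.1 p a (by push_cast at hp; omega) (by push_cast at hp; omega)

end LInftySuperalgebra

/-- A compatible pair from `(g, R, ρ)` to `(g', R', ρ')`: a homomorphism `g' → g` of Lie
superalgebras together with a `g'`-equivariant map `R → R'`. Cochains pull back along it. -/
structure CompatiblePair {g R g' R' : Type*} [AddCommGroup g] [Module ℝ g] [SuperSpace g]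
    [LieSuperalgebra g] [AddCommGroup R] [Module ℝ R] [SuperSpace R] [AddCommGroup g']
    [Module ℝ g'] [SuperSpace g'] [LieSuperalgebra g'] [AddCommGroup R'] [Module ℝ R']
    [SuperSpace R'] (ρ : SuperRep g R) (ρ' : SuperRep g' R') where
  lieMap : g' →ₗ[ℝ] g
  repMap : R →ₗ[ℝ] R'
  lieMap_mem : ∀ {a : ZMod 2} {x : g'}, x ∈ SuperSpace.part a → lieMap x ∈ SuperSpace.part a
  repMap_mem : ∀ {a : ZMod 2} {v : R}, v ∈ SuperSpace.part a → repMap v ∈ SuperSpace.part a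
  lieMap_bracket : ∀ x y : g', lieMap (LieSuperalgebra.bracket x y) =
    LieSuperalgebra.bracket (lieMap x) (lieMap y)
  repMap_act : ∀ (x : g') (v : R), repMap (ρ.act (lieMap x) v) = ρ'.act x (repMap v)

namespace CompatiblePair

variable {g R g' R' : Type*} [AddCommGroup g] [Module ℝ g] [SuperSpace g] [LieSuperalgebra g]
  [AddCommGroup R] [Module ℝ R] [SuperSpace R] [AddCommGroup g'] [Module ℝ g'] [SuperSpace g']
  [LieSuperalgebra g'] [AddCommGroup R'] [Module ℝ R'] [SuperSpace R'] {ρ : SuperRep g R}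
  {ρ' : SuperRep g' R'} {n : ℕ} (F : CompatiblePair ρ ρ')

/-- The pullback of multilinear maps along a compatible pair. -/
def pullback (θ : MultilinearMap ℝ (fun _ : Fin n => g) R) :
    MultilinearMap ℝ (fun _ : Fin n => g') R' :=
  F.repMap.compMultilinearMap (θ.compLinearMap fun _ => F.lieMap)

theorem pullback_apply (θ : MultilinearMap ℝ (fun _ : Fin n => g) R) (x : Fin n → g') :
    F.pullback θ x = F.repMap (θ fun i => F.lieMap (x i)) :=
  rfl

variable {F}

theorem isCochain_pullback {θ : MultilinearMap ℝ (fun _ : Fin n => g) R} (hθ : IsCochain θ) :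
    IsCochain (F.pullback θ) := by
  intro σ a x hx
  rw [pullback_apply, pullback_apply, ← map_zsmul]
  exact congrArg F.repMap (hθ σ a (fun i => F.lieMap (x i)) fun i => F.lieMap_mem (hx i))

theorem hasParity_pullback {c : ZMod 2} {θ : MultilinearMap ℝ (fun _ : Fin n => g) R}
    (hθ : HasParity c θ) : HasParity c (F.pullback θ) :=
  fun a _ hx => F.repMap_mem (hθ a _ fun i => F.lieMap_mem (hx i))

theorem coboundaryBracketPart_pullback (θ : MultilinearMap ℝ (fun _ : Fin n => g) R)
    (a : Fin (n + 1) → ZMod 2) (X : Fin (n + 1) → g') :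
    coboundaryBracketPart (F.pullback θ) a X =
      F.repMap (coboundaryBracketPart θ a fun i => F.lieMap (X i)) := by
  rcases n with _ | n
  · exact (map_zero F.repMap).symm
  · simp only [coboundaryBracketPart, map_sum, apply_ite F.repMap, map_zsmul, map_zero,
      pullback_apply]
    have lieMap_cons (i : Fin (n + 1)) (j : Fin (n + 2)) :
        (fun k => F.lieMap (Fin.cons (α := fun _ => g')
          (LieSuperalgebra.bracket (X i.castSucc) (X j))
          (fun k : Fin n => X (j.succAbove (i.succAbove k))) k)) =
        Fin.cons (α := fun _ => g)
          (LieSuperalgebra.bracket (F.lieMap (X i.castSucc)) (F.lieMap (X j)))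
          fun k : Fin n => F.lieMap (X (j.succAbove (i.succAbove k))) := by
      rw [← F.lieMap_bracket]
      exact Fin.comp_cons F.lieMap _ _
    simp only [lieMap_cons]

theorem coboundary_pullback (c : ZMod 2) (θ : MultilinearMap ℝ (fun _ : Fin n => g) R)
    (a : Fin (n + 1) → ZMod 2) (X : Fin (n + 1) → g') :
    coboundary ρ' c (F.pullback θ) a X =
      F.repMap (coboundary ρ c θ a fun i => F.lieMap (X i)) := by
  simp only [coboundary, coboundaryBracketPart_pullback, map_add, map_sum, map_zsmul,
    F.repMap_act, pullback_apply]

theorem isTrivialCocycle_pullback {ω : MultilinearMap ℝ (fun _ : Fin (n + 1) => g) R}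
    (hω : IsTrivialCocycle ρ ω) : IsTrivialCocycle ρ' (F.pullback ω) := by
  obtain ⟨θ₀, θ₁, hθ₀, even, hθ₁, odd, hd⟩ := hω
  refine ⟨F.pullback θ₀, F.pullback θ₁, isCochain_pullback hθ₀, hasParity_pullback even,
    isCochain_pullback hθ₁, hasParity_pullback odd, fun a X hX => ?_⟩
  rw [coboundary_pullback, coboundary_pullback, pullback_apply,
    hd a _ fun i => F.lieMap_mem (hX i), map_add]

end CompatiblePair

theorem range_eq_sup_map_part {V W : Type*} [AddCommGroup V] [Module ℝ V] [SuperSpace V]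
    [AddCommGroup W] [Module ℝ W] (e : V →ₗ[ℝ] W) :
    LinearMap.range e = (SuperSpace.part 0).map e ⊔ (SuperSpace.part 1).map e := by
  rw [← Submodule.map_sup, SuperSpace.isCompl.sup_eq_top, LinearMap.range_eq_map]

theorem exists_comp_eq_of_map_part_eq {V V' W : Type*} [AddCommGroup V] [Module ℝ V] [SuperSpace V]
    [AddCommGroup V'] [Module ℝ V'] [SuperSpace V'] [AddCommGroup W] [Module ℝ W]
    {e : V →ₗ[ℝ] W} {e' : V' →ₗ[ℝ] W} (he : Function.Injective e)
    (h : ∀ a, (SuperSpace.part a).map e = (SuperSpace.part a).map e') :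
    ∃ f : V' →ₗ[ℝ] V, (∀ x, e (f x) = e' x) ∧
      ∀ {a : ZMod 2} {x : V'}, x ∈ SuperSpace.part a → f x ∈ SuperSpace.part a := by
  have range_le (x : V') : e' x ∈ LinearMap.range e := by
    rw [range_eq_sup_map_part, h, h, ← range_eq_sup_map_part]
    exact LinearMap.mem_range_self e' x
  have comp_eq := LinearMap.codRestrictOfInjective_comp_apply e' e he range_le
  refine ⟨e'.codRestrictOfInjective e he range_le, comp_eq, fun {a x} hx => ?_⟩
  obtain ⟨y, hy, hxy⟩ : e' x ∈ (SuperSpace.part a).map e := by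
    rw [h]
    exact Submodule.mem_map_of_mem hx
  rwa [← he (hxy.trans (comp_eq x).symm)]

namespace LInftySuperalgebra

variable {W : Type*} [AddCommGroup W] [Module ℝ W] {A : LInftySuperalgebra W} {n : ℕ}

theorem CorrespondsTo.exists_compatiblePair {g R g' R' : Type*} [AddCommGroup g] [Module ℝ g]
    [SuperSpace g] [LieSuperalgebra g] [AddCommGroup R] [Module ℝ R] [SuperSpace R]
    [AddCommGroup g'] [Module ℝ g'] [SuperSpace g'] [LieSuperalgebra g'] [AddCommGroup R']
    [Module ℝ R'] [SuperSpace R'] {ρ : SuperRep g R} {ρ' : SuperRep g' R'}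
    {ω : MultilinearMap ℝ (fun _ : Fin (n + 2) => g) R}
    {ω' : MultilinearMap ℝ (fun _ : Fin (n + 2) => g') R'} (h : A.CorrespondsTo ρ ω)
    (h' : A.CorrespondsTo ρ' ω') : ∃ F : CompatiblePair ρ ρ', F.pullback ω = ω' := by
  obtain ⟨-, -, -, -, e₀, e₁, he₀, -, gr₀, gr₁, bracket, act, cocycle⟩ := h
  obtain ⟨-, -, -, -, e₀', e₁', -, he₁', gr₀', gr₁', bracket', act', cocycle'⟩ := h'
  obtain ⟨φ, hφ, φ_mem⟩ := exists_comp_eq_of_map_part_eq he₀ (e' := e₀') fun a => by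
    rw [gr₀, gr₀']
  obtain ⟨f, hf, f_mem⟩ := exists_comp_eq_of_map_part_eq he₁' (e' := e₁) fun a => by
    rw [gr₁, gr₁']
  refine ⟨⟨φ, f, φ_mem, f_mem, fun x y => he₀ ?_, fun x v => he₁' ?_⟩,
    MultilinearMap.ext fun x => he₁' ?_⟩
  · rw [hφ, ← bracket', ← bracket, hφ, hφ]
  · rw [hf, ← act', ← act, hφ, hf]
  · rw [CompatiblePair.pullback_apply, hf, ← cocycle, ← cocycle']
    simp only [hφ]

theorem IsExact.isTrivialCocycle {g R : Type*} [AddCommGroup g] [Module ℝ g] [SuperSpace g]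
    [LieSuperalgebra g] [AddCommGroup R] [Module ℝ R] [SuperSpace R] {ρ : SuperRep g R}
    {ω : MultilinearMap ℝ (fun _ : Fin (n + 2) => g) R} (hA : A.IsExact n)
    (h : A.CorrespondsTo ρ ω) : IsTrivialCocycle ρ ω := by
  obtain ⟨-, _, _, _, _, _, _, _, _, _, _, _, h', trivial'⟩ := hA
  obtain ⟨F, rfl⟩ := h'.exists_compatiblePair h
  exact CompatiblePair.isTrivialCocycle_pullback trivial'

end LInftySuperalgebra

section EvenBracket

variable {L R : Type*} [AddCommGroup L] [Module ℝ L] [SuperSpace L] [AddCommGroup R] [Module ℝ R]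

theorem IsCochain.apply_even_self {θ : MultilinearMap ℝ (fun _ : Fin 2 => L) R}
    (hθ : IsCochain θ) {x : L} (hx : x ∈ SuperSpace.part 0) : θ (fun _ => x) = 0 := by
  have swap_sign : chiSign (Equiv.swap 0 1 : Equiv.Perm (Fin 2)) (fun _ => 0) = -1 := by decide
  have antisymm := hθ (Equiv.swap 0 1) (fun _ => 0) (fun _ => x) fun _ => hx
  rw [swap_sign, neg_smul, one_smul] at antisymm
  have := IsAddTorsionFree.of_isTorsionFree ℝ R
  exact self_eq_neg.1 antisymm

variable [LieSuperalgebra L]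

theorem IsCochain.coboundaryBracketPart_eq_zero {θ : MultilinearMap ℝ (fun _ : Fin 2 => L) R}
    (hθ : IsCochain θ) (a : Fin 3 → ZMod 2) {x y : L}
    (even : LieSuperalgebra.bracket x y ∈ SuperSpace.part 0)
    (hx : LieSuperalgebra.bracket x (LieSuperalgebra.bracket x y) = 0)
    (hy : LieSuperalgebra.bracket y (LieSuperalgebra.bracket x y) = 0) :
    coboundaryBracketPart θ a ![x, y, LieSuperalgebra.bracket x y] = 0 := by
  refine Finset.sum_eq_zero fun i _ => Finset.sum_eq_zero fun j _ => ?_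
  refine ite_eq_right_iff.2 fun hij => ?_
  suffices vanish : θ (Fin.cons (LieSuperalgebra.bracket _ _) _) = 0 by rw [vanish, smul_zero]
  fin_cases i <;> fin_cases j
  · exact absurd hij (by decide)
  · exact (congrArg θ (funext fun k => by fin_cases k <;> rfl)).trans (hθ.apply_even_self even)
  · exact θ.map_coord_zero 0 hx
  · exact absurd hij (by decide)
  · exact absurd hij (by decide)
  · exact θ.map_coord_zero 0 hy

theorem IsTrivialCocycle.apply_eq_zero [SuperSpace R]
    {ω : MultilinearMap ℝ (fun _ : Fin 3 => L) R}
    (hω : IsTrivialCocycle (SuperRep.trivial L R) ω) {a b : ZMod 2} {x y : L}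
    (ha : x ∈ SuperSpace.part a) (hb : y ∈ SuperSpace.part b)
    (even : LieSuperalgebra.bracket x y ∈ SuperSpace.part 0)
    (hx : LieSuperalgebra.bracket x (LieSuperalgebra.bracket x y) = 0)
    (hy : LieSuperalgebra.bracket y (LieSuperalgebra.bracket x y) = 0) :
    ω ![x, y, LieSuperalgebra.bracket x y] = 0 := by
  obtain ⟨θ₀, θ₁, hθ₀, -, hθ₁, -, hd⟩ := hω
  rw [hd ![a, b, 0] _ (Fin.forall_fin_succ.2 ⟨ha, Fin.forall_fin_two.2 ⟨hb, even⟩⟩),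
    coboundary_trivial, coboundary_trivial, hθ₀.coboundaryBracketPart_eq_zero _ even hx hy,
    hθ₁.coboundaryBracketPart_eq_zero _ even hx hy, add_zero]

end EvenBracket

section StringCocycle

variable {K : Type*} [NonAssocRing K] [StarRing K] [Module ℝ K] [NormedDivisionAlgebra K]

theorem divRe_one : divRe (1 : K) = 1 := by
  have two_smul_eq := NormedDivisionAlgebra.add_star_eq (1 : K)
  rw [star_one, ← two_smul ℝ (1 : K)] at two_smul_eq
  have two_eq := smul_left_injective ℝ (one_ne_zero (α := K)) two_smul_eq
  simp only [divRe]
  linarith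

theorem exists_minkowski_spinorBracket_ne_zero :
    ∃ ψ φ : Spinor K, minkowski (spinorBracket ψ φ) (spinorBracket ψ φ) ≠ 0 := by
  refine ⟨![1, 0], ![0, 1], ?_⟩
  rw [minkowski_self]
  simp [spinorBracket, spinorOuter, traceReversal, Matrix.vecMulVec, Matrix.trace_fin_two,
    divRe_one]

theorem stringCocycle_not_isTrivialCocycle :
    ¬ IsTrivialCocycle (SuperRep.trivial (SuperTranslation K) ℝ) stringCocycle := by
  intro is_trivial
  obtain ⟨ψ, φ, ne_zero⟩ := exists_minkowski_spinorBracket_ne_zero (K := K)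
  have bracket_vector (χ : Spinor K) (A : Vec K) :
      LieSuperalgebra.bracket ((0, χ) : SuperTranslation K) (A, 0) = 0 :=
    Prod.ext (map_zero (spinorBracket χ)) rfl
  have apply_eq_zero := is_trivial.apply_eq_zero (a := 1) (b := 1) (x := (0, ψ))
    (y := (0, φ)) ⟨ψ, rfl⟩ ⟨φ, rfl⟩ ⟨_, rfl⟩ (bracket_vector ψ _) (bracket_vector φ _)
  exact ne_zero ((stringCocycle_spinor_spinor_vector ψ φ _).symm.trans apply_eq_zero)

end StringCocycle

theorem cyclic_sum_eq_zero_of_forall_null {M N : Type*} [AddCommGroup M] [Module ℝ M]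
    [AddCommGroup N] [Module ℝ N] {B : M →ₗ[ℝ] M →ₗ[ℝ] N} {g : N →ₗ[ℝ] N →ₗ[ℝ] ℝ}
    (hB : ∀ x y, B x y = B y x) (hg : ∀ u v, g u v = g v u)
    (null : ∀ x, g (B x x) (B x x) = 0) (x₀ x₁ x₂ x₃ : M) :
    g (B x₀ x₁) (B x₂ x₃) + g (B x₀ x₂) (B x₁ x₃) + g (B x₀ x₃) (B x₁ x₂) = 0 := by
  have cube (x y : M) : g (B x x) (B x y) = 0 := by
    have add := null (x + y)
    have sub := null (x - y)
    have add_two := null (x + (2 : ℝ) • y)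
    simp only [map_add, map_sub, map_smul, LinearMap.add_apply, LinearMap.sub_apply,
      LinearMap.smul_apply, smul_eq_mul, hB y x, hg (B x y) (B x x), hg (B y y) (B x x),
      hg (B y y) (B x y), null] at add sub add_two
    linarith
  have sum₀₁₂ := cube (x₀ + x₁ + x₂) x₃
  have sum₀₁ := cube (x₀ + x₁) x₃
  have sum₀₂ := cube (x₀ + x₂) x₃
  have sum₁₂ := cube (x₁ + x₂) x₃
  simp only [map_add, LinearMap.add_apply, hB x₁ x₀, hB x₂ x₀, hB x₂ x₁, cube]
    at sum₀₁₂ sum₀₁ sum₀₂ sum₁₂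
  linarith [hg (B x₁ x₂) (B x₀ x₃)]

section StringCocycle

variable {K : Type*} [NonAssocRing K] [StarRing K] [Module ℝ K] [NormedDivisionAlgebra K]

theorem minkowski_comm (A B : Vec K) : minkowski A B = minkowski B A := by
  have off_diagonal := divRe_mul_star_comm (A.1 0 1) (B.1 0 1)
  simp only [minkowski, LinearMap.mk₂_apply]
  linarith

theorem minkowski_spinorBracket_self (ψ : Spinor K) :
    minkowski (spinorBracket ψ ψ) (spinorBracket ψ ψ) = 0 := by
  have normSq_mul : divRe (ψ 0 * star (ψ 1) * star (ψ 0 * star (ψ 1))) =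
      divRe (ψ 0 * star (ψ 0)) * divRe (star (ψ 1) * star (star (ψ 1))) :=
    NormedDivisionAlgebra.normSq_mul (ψ 0) (star (ψ 1))
  rw [star_star, divRe_mul_comm (star (ψ 1)) (ψ 1)] at normSq_mul
  have entry₀₀ : (spinorBracket ψ ψ).1 0 0 = -(2 : ℝ) • (ψ 1 * star (ψ 1)) := by
    simp [spinorBracket, spinorOuter, traceReversal, Matrix.vecMulVec, Matrix.trace_fin_two,
      two_smul]
  have entry₁₁ : (spinorBracket ψ ψ).1 1 1 = -(2 : ℝ) • (ψ 0 * star (ψ 0)) := by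
    simp [spinorBracket, spinorOuter, traceReversal, Matrix.vecMulVec, Matrix.trace_fin_two,
      two_smul]
  have entry₀₁ : (spinorBracket ψ ψ).1 0 1 = (2 : ℝ) • (ψ 0 * star (ψ 1)) := by
    simp [spinorBracket, spinorOuter, traceReversal, Matrix.vecMulVec, two_smul]
  rw [minkowski_self, entry₀₀, entry₁₁, entry₀₁, star_smul, star_trivial (2 : ℝ),
    smul_mul_smul_comm]
  simp only [map_smul, smul_eq_mul, normSq_mul]
  ring

-- The polarized `3`-`ψ` rule `(ψ · ψ)ψ = 0`, since `g(φ · ψ, A) = Re(φ† (A ψ))`.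
theorem minkowski_spinorBracket_cyclic (ψ₀ ψ₁ ψ₂ ψ₃ : Spinor K) :
    minkowski (spinorBracket ψ₀ ψ₁) (spinorBracket ψ₂ ψ₃) +
      minkowski (spinorBracket ψ₀ ψ₂) (spinorBracket ψ₁ ψ₃) +
      minkowski (spinorBracket ψ₀ ψ₃) (spinorBracket ψ₁ ψ₂) = 0 :=
  cyclic_sum_eq_zero_of_forall_null (M := Spinor K) (N := Vec K) spinorBracket_comm
    minkowski_comm minkowski_spinorBracket_self ψ₀ ψ₁ ψ₂ ψ₃

theorem SuperTranslation.snd_eq_zero {X : SuperTranslation K} (hX : X ∈ SuperSpace.part 0) :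
    X.2 = 0 := by
  obtain ⟨A, rfl⟩ := hX
  rfl

theorem SuperTranslation.fst_eq_zero {X : SuperTranslation K} (hX : X ∈ SuperSpace.part 1) :
    X.1 = 0 := by
  obtain ⟨ψ, rfl⟩ := hX
  rfl

theorem stringCocycle_apply (X : Fin 3 → SuperTranslation K) :
    stringCocycle X = minkowski (spinorBracket (X 0).2 (X 1).2) (X 2).1 -
      minkowski (spinorBracket (X 0).2 (X 2).2) (X 1).1 +
      minkowski (spinorBracket (X 1).2 (X 2).2) (X 0).1 :=
  rfl

theorem stringCocycle_isCochain : IsCochain (stringCocycle (K := K)) := by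
  refine isCochain_of_swap_castSucc_succ fun i a x hx => ?_
  have sign_zero : paritySign 0 = 1 := rfl
  have sign_one : paritySign 1 = -1 := rfl
  have snd_eq_zero (i) (h : a i = 0) : (x i).2 = 0 := SuperTranslation.snd_eq_zero (h ▸ hx i)
  have fst_eq_zero (i) (h : a i = 1) : (x i).1 = 0 := SuperTranslation.fst_eq_zero (h ▸ hx i)
  have swap_zero_one : (Equiv.swap 0 1 : Equiv.Perm (Fin 3)) 2 = 2 := by decide
  have swap_one_two : (Equiv.swap 1 2 : Equiv.Perm (Fin 3)) 0 = 0 := by decide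
  rcases Fin.exists_fin_two.1 ⟨i, rfl⟩ with rfl | rfl
  · rcases parity_eq_zero_or_one (a 0) with a₀ | a₀ <;>
    rcases parity_eq_zero_or_one (a 1) with a₁ | a₁ <;>
    simp [stringCocycle_apply, swap_zero_one, a₀, a₁, snd_eq_zero, fst_eq_zero, sign_zero,
      sign_one, spinorBracket_comm (x 1).2 (x 0).2]
  · rcases parity_eq_zero_or_one (a 1) with a₁ | a₁ <;>
    rcases parity_eq_zero_or_one (a 2) with a₂ | a₂ <;>
    simp [stringCocycle_apply, swap_one_two, a₁, a₂, snd_eq_zero, fst_eq_zero, sign_zero,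
      sign_one, spinorBracket_comm (x 2).2 (x 1).2]

theorem stringCocycle_hasParity : HasParity 0 (stringCocycle (K := K)) := by
  intro a x hx
  have snd_eq_zero (i) (h : a i = 0) : (x i).2 = 0 := SuperTranslation.snd_eq_zero (h ▸ hx i)
  have fst_eq_zero (i) (h : a i = 1) : (x i).1 = 0 := SuperTranslation.fst_eq_zero (h ▸ hx i)
  rw [stringCocycle_apply]
  rcases parity_eq_zero_or_one (a 0) with a₀ | a₀ <;>
  rcases parity_eq_zero_or_one (a 1) with a₁ | a₁ <;>
  rcases parity_eq_zero_or_one (a 2) with a₂ | a₂ <;>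
  simp [Fin.sum_univ_three, a₀, a₁, a₂, snd_eq_zero, fst_eq_zero, SuperSpace.part,
    CharTwo.add_self_eq_zero]

theorem stringCocycle_cons_bracket (X Y : SuperTranslation K) (f : Fin 2 → SuperTranslation K) :
    stringCocycle (Fin.cons (LieSuperalgebra.bracket X Y) f) =
      minkowski (spinorBracket (f 0).2 (f 1).2) (spinorBracket X.2 Y.2) := by
  have snd_bracket : (LieSuperalgebra.bracket X Y).2 = 0 := rfl
  rw [stringCocycle_apply, Fin.cons_zero, snd_bracket]
  simp only [map_zero, LinearMap.zero_apply, zero_sub, neg_zero, zero_add]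
  rfl

theorem sum_minkowski_spinorBracket_eq_zero (ψ : Fin 4 → Spinor K) :
    ∑ i : Fin 3, ∑ j : Fin 4, (if i.castSucc < j then
      minkowski (spinorBracket (ψ (j.succAbove (i.succAbove 0)))
        (ψ (j.succAbove (i.succAbove 1)))) (spinorBracket (ψ i.castSucc) (ψ j)) else 0) = 0 := by
  rw [Fin.sum_univ_three, Fin.sum_univ_four, Fin.sum_univ_four, Fin.sum_univ_four]
  change 0 + minkowski (spinorBracket (ψ 2) (ψ 3)) (spinorBracket (ψ 0) (ψ 1)) +
      minkowski (spinorBracket (ψ 1) (ψ 3)) (spinorBracket (ψ 0) (ψ 2)) +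
      minkowski (spinorBracket (ψ 1) (ψ 2)) (spinorBracket (ψ 0) (ψ 3)) +
      (0 + 0 + minkowski (spinorBracket (ψ 0) (ψ 3)) (spinorBracket (ψ 1) (ψ 2)) +
        minkowski (spinorBracket (ψ 0) (ψ 2)) (spinorBracket (ψ 1) (ψ 3))) +
      (0 + 0 + 0 + minkowski (spinorBracket (ψ 0) (ψ 1)) (spinorBracket (ψ 2) (ψ 3))) = 0
  rw [minkowski_comm (spinorBracket (ψ 2) (ψ 3)), minkowski_comm (spinorBracket (ψ 1) (ψ 3)),
    minkowski_comm (spinorBracket (ψ 1) (ψ 2))]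
  linarith [minkowski_spinorBracket_cyclic (ψ 0) (ψ 1) (ψ 2) (ψ 3)]

theorem coboundaryBracketPart_stringCocycle_of_odd (X : Fin 4 → SuperTranslation K) :
    coboundaryBracketPart stringCocycle (fun _ => 1) X = 0 := by
  have sign (i : Fin 3) (j : Fin 4) (hij : i.castSucc < j) :
      (-1) ^ ((i : ℕ) + (j : ℕ)) * paritySign (1 * 1) *
        frontSign (fun _ : Fin 4 => 1) i.castSucc * frontSign (fun _ : Fin 4 => 1) j = -1 := by
    revert i j; decide
  rw [← neg_eq_zero, ← sum_minkowski_spinorBracket_eq_zero fun i => (X i).2]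
  simp only [coboundaryBracketPart, ← Finset.sum_neg_distrib]
  refine Finset.sum_congr rfl fun i _ => Finset.sum_congr rfl fun j _ => ?_
  split_ifs with hij
  · rw [sign i j hij, neg_one_smul, neg_neg, stringCocycle_cons_bracket]
  · rw [neg_zero]

theorem coboundaryBracketPart_stringCocycle_of_snd_eq_zero (a : Fin 4 → ZMod 2)
    {X : Fin 4 → SuperTranslation K} {m : Fin 4} (hm : (X m).2 = 0) :
    coboundaryBracketPart stringCocycle a X = 0 := by
  have mem_indices (i : Fin 3) (j : Fin 4) (hij : i.castSucc < j) : m = i.castSucc ∨ m = j ∨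
      m = j.succAbove (i.succAbove 0) ∨ m = j.succAbove (i.succAbove 1) := by
    clear hm; revert m i j; decide
  refine Finset.sum_eq_zero fun i _ => Finset.sum_eq_zero fun j _ =>
    ite_eq_right_iff.2 fun hij => ?_
  rw [stringCocycle_cons_bracket]
  rcases mem_indices i j hij with rfl | rfl | rfl | rfl <;> simp [hm]

theorem stringCocycle_isEvenCocycle :
    IsEvenCocycle (SuperRep.trivial (SuperTranslation K) ℝ) (stringCocycle (K := K)) := by
  refine ⟨stringCocycle_isCochain, stringCocycle_hasParity, fun a X hX => ?_⟩
  rw [coboundary_trivial]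
  by_cases odd : ∀ i, a i = 1
  · obtain rfl : a = fun _ => 1 := funext odd
    exact coboundaryBracketPart_stringCocycle_of_odd X
  · push Not at odd
    obtain ⟨m, hm⟩ := odd
    have even := (parity_eq_zero_or_one (a m)).resolve_right hm
    exact coboundaryBracketPart_stringCocycle_of_snd_eq_zero a
      (SuperTranslation.snd_eq_zero (even ▸ hX m))

end StringCocycle

section Dimension

variable {K : Type*} [NonAssocRing K] [StarRing K] [Module ℝ K] [NormedDivisionAlgebra K]

/-- The coordinates of a hermitian matrix: the real diagonal entries and the entry above the
diagonal. -/
noncomputable def vecEquiv : Vec K ≃ₗ[ℝ] ℝ × ℝ × K where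
  toFun A := (divRe (A.1 0 0), divRe (A.1 1 1), A.1 0 1)
  invFun x := ⟨!![x.1 • 1, x.2.2; star x.2.2, x.2.1 • 1], by
    change Matrix.conjTranspose _ = _
    ext i j
    fin_cases i <;> fin_cases j <;> simp⟩
  map_add' A B := by simp
  map_smul' c A := by simp
  left_inv A := by
    have hermitian (i j : Fin 2) : star (A.1 j i) = A.1 i j := congrFun (congrFun A.2 i) j
    apply Subtype.ext
    ext i j
    fin_cases i <;> fin_cases j
    · exact (eq_divRe_smul_one (hermitian 0 0)).symm
    · rfl
    · exact hermitian 1 0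
    · exact (eq_divRe_smul_one (hermitian 1 1)).symm
  right_inv x := by simp [divRe_one]

theorem finrank_vec : Module.finrank ℝ (Vec K) = Module.finrank ℝ K + 2 := by
  rw [vecEquiv.finrank_eq, Module.finrank_prod, Module.finrank_prod, Module.finrank_self]
  ring

theorem Octonion.finrank_eq_eight : Module.finrank ℝ Octonion = 8 := by
  change Module.finrank ℝ (Quaternion ℝ × Quaternion ℝ) = 8
  rw [Module.finrank_prod, Quaternion.finrank_eq_four]

end Dimension

theorem mainTheorem8 :
    (Module.finrank ℝ (Vec ℝ) = 3 ∧ Module.finrank ℝ (Vec ℂ) = 4 ∧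
      Module.finrank ℝ (Vec (Quaternion ℝ)) = 6 ∧ Module.finrank ℝ (Vec Octonion) = 10) ∧
    ∀ (K : Type*) [NonAssocRing K] [StarRing K] [Module ℝ K] [NormedDivisionAlgebra K],
      ∃ A : LInftySuperalgebra (SuperTranslation K × ℝ),
        A.IsLie 2 ∧
        A.CorrespondsTo (n := 1) (SuperRep.trivial (SuperTranslation K) ℝ) stringCocycle ∧
        A.IsExtension (SuperTranslation K) ℝ 1 ∧
        ¬ A.IsExact 1 := by
  refine ⟨⟨?_, ?_, ?_, ?_⟩, fun K _ _ _ _ => ?_⟩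
  · rw [finrank_vec, Module.finrank_self]
  · rw [finrank_vec, Complex.finrank_real_complex]
  · rw [finrank_vec, Quaternion.finrank_eq_four]
  · rw [finrank_vec, Octonion.finrank_eq_eight]
  · have corresponds := LInftySuperalgebra.ofCocycle_correspondsTo
      (stringCocycle (K := K)) stringCocycle_isEvenCocycle one_pos
    exact ⟨_, corresponds.isLie, corresponds, LInftySuperalgebra.ofCocycle_isExtension _ _,
      fun isExact => stringCocycle_not_isTrivialCocycle (isExact.isTrivialCocycle corresponds)⟩
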